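/- Let $\mathscr H$ be a real finite-dimensional Hilbert space, $h:\mathscr H\to\mathbb R$ convex and continuously differentiable, and $\phi:\mathscr H\to\mathbb R\cup\{+\infty\}$ proper, convex and lower semicontinuous. Let $\eta,L,\gamma>0$ be such that $\langle\nabla h(x)-\nabla h(y),x-y\rangle\ge\eta\|x-y\|^2$ and $\|\nabla h(x)-\nabla h(y)\|\le L\|x-y\|$ for all $x,y\in\mathscr H$, and $\gamma L^2<2\eta$. Put $$B(z)=\mathrm{prox}_{\gamma\phi}\big(z-\gamma\nabla h(z)\big),\qquad \Phi(z)=z-B(z),\qquad \mathrm{prox}_{\gamma\phi}(z)=\arg\min_{w}\Big\{\phi(w)+\tfrac1{2\gamma}\|z-w\|^2\Big\}.$$ For $b_1,b_2,b_3>0$, $p_1\in(0,1)$, $p_2>1$, $p_3\ge0$, $K_p,T_p>0$ consider on $[0,\infty)$ $$\dot z=-\frac{K_p}{T_p}\,\omega(z)\,\Phi(z),\qquad \omega(z)=\begin{cases}\dfrac{b_1}{\|\Phi(z)\|^{1-p_1}}+\dfrac{b_2}{\|\Phi(z)\|^{1-p_2}}+\dfrac{b_3}{\|\Phi(z)\|^{p_3}},&\Phi(z)\ne0,\\[1mm]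 0,&\Phi(z)=0.\end{cases}\tag{1}$$ Solutions are understood in the Carathéodory sense (locally absolutely continuous, equation almost everywhere); the settling time of a solution $z$ at $z^*$ is $T(z(0))=\inf\{T\ge0: z(t)=z^*\ \forall t\ge T\}$. A point $z^*$ is called a fixed-time stable equilibrium if it is an equilibrium (zero of the right-hand side), is Lyapunov stable, every initial point in $\mathscr H$ admits a solution, every solution has finite settling time, and the settling times are bounded uniformly over all initial points. Let $z^*$ be a minimizer of $h+\phi$ over $\mathscr H$. Then: 1. There is $c\in(0,1)$ such that $B$ is Lipschitz continuous with constant $c$. 2. For all $p_3\ge0$ and $K_p,T_p>0$, $z^*$ is a (globally) fixed-time stable equilibrium of (1). Moreover, for every $c\in(0,1)$ for which $B$ is $c$-Lipschitz, put $$M_1=2^{\frac{1+p_1}2}\frac{K_p}{T_p}\,\frac{b_1(1-c)}{(1+c)^{1-p_1}},\quad M_2=2^{\frac{1+p_2}2}\frac{K_p}{T_p}(1-c)^{p_2}b_2,\quad r_1=\frac{1+p_1}2,\quad r_2=\frac{1+p_2}2.$$ Then $M_1,M_2>0$, $r_1\in(\tfrac12,1)$, $r_2>1$, and every solution satisfies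 $$T(z(0))\le\frac1{M_1(1-r_1)}+\frac1{M_2(r_2-1)};$$ if in addition $r_1=1-\frac1{2\alpha}$ and $r_2=1+\frac1{2\alpha}$ for some $\alpha>1$, then every solution satisfies $T(z(0))\le\dfrac{\pi\alpha}{\sqrt{M_1M_2}}$. 3. Let $p_3=0$. Then $z^*$ is predefined-time stable: for every $c\in(0,1)$ for which $B$ is $c$-Lipschitz and every prescribed $T_p>0$, with the gain $$K_p=\frac{1}{b_3(1-c)(1-p_1)}\ln\!\Big(1+\frac{b_3\,2^{\frac{1-p_1}2}(1+c)^{1-p_1}}{b_1}\Big)+\frac{1}{b_3(1-c)(p_2-1)}\ln\!\Big(1+\frac{b_3\,2^{\frac{1-p_2}2}(1-c)^{1-p_2}}{b_2}\Big),$$ $z^*$ is a fixed-time stable equilibrium of (1) and every solution satisfies $T(z(0))\le T_p$. -/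

import Mathlib

open scoped NNReal ENNReal

/-- `φ : H → ℝ ∪ {+∞}` is proper: it never takes the value `-∞` and is not identically `+∞`. -/
def IsProperFun {H : Type*} (φ : H → EReal) : Prop :=
  (∀ z, φ z ≠ ⊥) ∧ ∃ z, φ z ≠ ⊤

/-- Convexity of an extended-real-valued function. -/
def IsConvexFun {H : Type*} [AddCommGroup H] [Module ℝ H] (φ : H → EReal) : Prop :=
  ∀ x y : H, ∀ a b : ℝ, 0 < a → 0 < b → a + b = 1 →
    φ (a • x + b • y) ≤ (a : EReal) * φ x + (b : EReal) * φ y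

/-- `p` minimizes `w ↦ φ w + ‖z - w‖² / (2 γ)` over the whole space. -/
def IsProxPoint {H : Type*} [NormedAddCommGroup H] (γ : ℝ) (φ : H → EReal) (z p : H) : Prop :=
  IsMinOn (fun w => φ w + ((1 / (2 * γ) * ‖z - w‖ ^ 2 : ℝ) : EReal)) Set.univ p

/-- The proximity operator `prox_{γφ}`: the minimizer of `w ↦ φ w + ‖z - w‖² / (2 γ)`. -/
noncomputable def prox {H : Type*} [NormedAddCommGroup H] (γ : ℝ) (φ : H → EReal) (z : H) : H :=
  Classical.epsilon (IsProxPoint γ φ z)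

/-- The forward-backward operator `B z = prox_{γφ} (z - γ ∇h(z))`. -/
noncomputable def fwdBwd {H : Type*} [NormedAddCommGroup H] [InnerProductSpace ℝ H]
    [CompleteSpace H] (γ : ℝ) (h : H → ℝ) (φ : H → EReal) (z : H) : H :=
  prox γ φ (z - γ • gradient h z)

/-- The residual `Φ z = z - prox_{γφ} (z - γ ∇h(z))`. -/
noncomputable def fbResidual {H : Type*} [NormedAddCommGroup H] [InnerProductSpace ℝ H]
    [CompleteSpace H] (γ : ℝ) (h : H → ℝ) (φ : H → EReal) (z : H) : H :=
  z - fwdBwd γ h φ z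

open Classical in
/-- The scalar factor `ω` built from `Φ`; it vanishes on the zeros of `Φ`. -/
noncomputable def omegaFactor {H : Type*} [NormedAddCommGroup H] (Φ : H → H)
    (b₁ b₂ b₃ p₁ p₂ p₃ : ℝ) (z : H) : ℝ :=
  if Φ z = 0 then 0
  else b₁ * (1 / ‖Φ z‖ ^ (1 - p₁)) + b₂ * (1 / ‖Φ z‖ ^ (1 - p₂)) + b₃ * (1 / ‖Φ z‖ ^ p₃)

/-- The right-hand side `z ↦ -(Kp / Tp) ω(z) Φ(z)` of the dynamical system. -/
noncomputable def fieldRHS {H : Type*} [NormedAddCommGroup H] [InnerProductSpace ℝ H]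
    (Φ : H → H) (b₁ b₂ b₃ p₁ p₂ p₃ Kp Tp : ℝ) (z : H) : H :=
  (-(Kp / Tp) * omegaFactor Φ b₁ b₂ b₃ p₁ p₂ p₃ z) • Φ z

/-- `z` is a (Carathéodory) solution on `[0, ∞)` of `ż = V(z)`: `V ∘ z` is integrable on bounded
intervals and `z t = z 0 + ∫₀ᵗ V(z s) ds`, i.e. `z` is locally absolutely continuous and satisfies
the equation almost everywhere. If `V` is continuous these are exactly the `C¹` solutions. -/
def IsTrajectory {H : Type*} [NormedAddCommGroup H] [NormedSpace ℝ H]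
    (V : H → H) (z : ℝ → H) : Prop :=
  ∀ t : ℝ, 0 ≤ t →
    IntervalIntegrable (fun s => V (z s)) MeasureTheory.volume 0 t ∧
      z t = z 0 + ∫ s in (0 : ℝ)..t, V (z s)

/-- The settling time of the trajectory `z` at `zs`: the infimum of the `T ≥ 0` such that
`z t = zs` for all `t ≥ T` (`∞` if there is no such `T`). -/
noncomputable def settlingTime {H : Type*} (z : ℝ → H) (zs : H) : ℝ≥0∞ :=
  ⨅ (T : ℝ≥0) (_ : ∀ t : ℝ, (T : ℝ) ≤ t → z t = zs), (T : ℝ≥0∞)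

/-- Lyapunov stability of `zs` for `ż = V(z)`. -/
def IsLyapunovStable {H : Type*} [NormedAddCommGroup H] [NormedSpace ℝ H]
    (V : H → H) (zs : H) : Prop :=
  ∀ ε > 0, ∃ r > 0, ∀ z : ℝ → H, IsTrajectory V z → z 0 ∈ Metric.ball zs r →
    ∀ t > 0, z t ∈ Metric.ball zs ε

/-- `zs` is a globally finite-time stable equilibrium of `ż = V(z)`: it is a Lyapunov stable
equilibrium, every initial condition admits a trajectory, and every trajectory has a finite
settling time. -/
structure IsGloballyFiniteTimeStable {H : Type*} [NormedAddCommGroup H] [NormedSpace ℝ H]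
    (V : H → H) (zs : H) : Prop where
  equilibrium : V zs = 0
  lyapunov : IsLyapunovStable V zs
  exists_trajectory : ∀ z₀ : H, ∃ z : ℝ → H, IsTrajectory V z ∧ z 0 = z₀
  settling_finite : ∀ z : ℝ → H, IsTrajectory V z → settlingTime z zs < ⊤

/-- The settling times of all trajectories of `ż = V(z)` at `zs` are at most `Tmax`. -/
def SettlesWithin {H : Type*} [NormedAddCommGroup H] [NormedSpace ℝ H]
    (V : H → H) (zs : H) (Tmax : ℝ) : Prop :=
  ∀ z : ℝ → H, IsTrajectory V z → settlingTime z zs ≤ ENNReal.ofReal Tmax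

/-- Globally fixed-time stable: globally finite-time stable with settling time bounded
uniformly over all initial conditions. -/
structure IsFixedTimeStable {H : Type*} [NormedAddCommGroup H] [NormedSpace ℝ H]
    (V : H → H) (zs : H) : Prop extends IsGloballyFiniteTimeStable V zs where
  settling_bounded : ∃ Tmax : ℝ, SettlesWithin V zs Tmax

/-- Predefined-time stability of `zs` for the family of systems `ż = V Tp z` tuned by the
parameter `Tp > 0`: each of them is globally fixed-time stable and settles within the prescribed
time `Tp`. -/
def IsPredefinedTimeStable {H : Type*} [NormedAddCommGroup H] [NormedSpace ℝ H]
    (V : ℝ → H → H) (zs : H) : Prop :=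
  ∀ Tp : ℝ, 0 < Tp → IsFixedTimeStable (V Tp) zs ∧ SettlesWithin (V Tp) zs Tp

/-- The constant `M₁` of the settling-time bound. -/
noncomputable def boundM₁ (b₁ p₁ c Kp Tp : ℝ) : ℝ :=
  (2 : ℝ) ^ ((1 + p₁) / 2) * (Kp / Tp) * (b₁ * (1 - c) / (1 + c) ^ (1 - p₁))

/-- The constant `M₂` of the settling-time bound. -/
noncomputable def boundM₂ (b₂ p₂ c Kp Tp : ℝ) : ℝ :=
  (2 : ℝ) ^ ((1 + p₂) / 2) * (Kp / Tp) * (1 - c) ^ p₂ * b₂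

/-- The gain `Kp` for predefined-time stability. -/
noncomputable def predefinedGain (b₁ b₂ b₃ p₁ p₂ c : ℝ) : ℝ :=
  1 / (b₃ * (1 - c) * (1 - p₁)) *
      Real.log (1 + b₃ * (2 : ℝ) ^ ((1 - p₁) / 2) * (1 + c) ^ (1 - p₁) / b₁) +
    1 / (b₃ * (1 - c) * (p₂ - 1)) *
      Real.log (1 + b₃ * (2 : ℝ) ^ ((1 - p₂) / 2) * (1 - c) ^ (1 - p₂) / b₂)

/-! The forward step `x ↦ x - γ ∇h(x)` contracts squared distances by `1 - 2γη + γ²L² < 1` and the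
proximity operator is nonexpansive, so `B` is a contraction; the optimality condition at `zs` says
that `zs` is its fixed point. Writing `ρ = ‖x - zs‖`, this gives `(1 - c)ρ ≤ ‖Φ x‖ ≤ (1 + c)ρ` and
`⟪x - zs, Φ x⟫ ≥ (1 - c)ρ²`, which is all that the dynamics need to know about `h` and `φ`.

Take the energy `W = ρ²/2`. Along a solution away from `zs` these bounds yield `W' ≤ -g(W)` with
`g(w) = M₁w^r₁ + M₂w^r₂`, and an extra term `M₃w` when `p₃ = 0` (`inner_fieldRHS_le_rpow`,
`inner_fieldRHS_le_rpow_add_linear`). The time to reach `zs` is then at most `∫₀^∞ dw / g(w)`: the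
sublinear power makes it converge at `0`, the superlinear one at `∞`, whence uniformity in the
initial point. The three explicit bounds come from three ways of estimating this integral
(`elapsed_time_le` and the `hasSettlingBound` lemmas).

Existence needs its own argument, since the field may be discontinuous or even unbounded at `zs`. In
`exists_isTrajectory_of_timeChange` the Lipschitz flow of `-Φ`, which approaches `zs` without
reaching it, is run at speed `κ = (Kp/Tp)ω`. The settling bound shows that its infinite lifetime is
compressed into a finite one, after which the curve rests at `zs`. Near arrival the velocity is
integrable because it makes a bounded angle with the direction to `zs` (`integrableOn_of_angle`). -/

open Filter Topology Set MeasureTheory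

/-! ### Proximity operator and contraction of the forward-backward map. -/

section ForwardBackward

variable {H : Type*} [NormedAddCommGroup H] [InnerProductSpace ℝ H] [CompleteSpace H]

/-- First order condition for minimizing the sum of a differentiable and a convex function:
minus the gradient is a subgradient of the convex part. -/
theorem exists_affine_minorant_of_isMinOn_add {f : H → ℝ} {φ : H → EReal} {p g : H}
    (hf : HasGradientAt f g p) (hφ : IsProperFun φ) (hc : IsConvexFun φ)
    (hp : IsMinOn (fun w => (f w : EReal) + φ w) univ p) :
    ∃ a : ℝ, φ p = a ∧ ∀ w, ((a - inner ℝ g (w - p) : ℝ) : EReal) ≤ φ w := by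
  have hmin : ∀ w, (f p : EReal) + φ p ≤ (f w : EReal) + φ w := fun w => hp (mem_univ w)
  have hfin : φ p ≠ ⊤ := by
    intro htop
    obtain ⟨w, hw⟩ := hφ.2
    have h1 := hmin w
    lift φ w to ℝ using ⟨hw, hφ.1 w⟩ with b
    rw [htop, EReal.coe_add_top, ← EReal.coe_add] at h1
    exact EReal.coe_ne_top _ (top_le_iff.1 h1)
  obtain ⟨a, ha⟩ : ∃ a : ℝ, (a : EReal) = φ p := ⟨_, EReal.coe_toReal hfin (hφ.1 p)⟩
  refine ⟨a, ha.symm, fun w => ?_⟩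
  by_cases hw : φ w = ⊤
  · simp [hw]
  obtain ⟨b, hb⟩ : ∃ b : ℝ, (b : EReal) = φ w := ⟨_, EReal.coe_toReal hw (hφ.1 w)⟩
  rw [← hb, EReal.coe_le_coe_iff]
  -- Minimality is tested on the segment from `p` to `w`, where convexity bounds `φ` linearly in
  -- `t`; dividing by `t` and letting `t → 0⁺` gives the subgradient inequality.
  have hsec : ∀ t : ℝ, 0 < t → t < 1 → f p - t * (b - a) ≤ f (p + t • (w - p)) := by
    intro t h0 h1
    have hx := hc p w (1 - t) t (by linarith) h0 (by ring)
    have hpt : (1 - t) • p + t • w = p + t • (w - p) := by module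
    rw [hpt, ← ha, ← hb] at hx
    have hy := (hmin (p + t • (w - p))).trans (add_le_add_right hx _)
    rw [← ha] at hy
    norm_cast at hy
    linarith
  have hder : HasDerivAt (fun t : ℝ => f (p + t • (w - p))) (inner ℝ g (w - p)) 0 := by
    have hl : HasDerivAt (fun t : ℝ => p + t • (w - p)) (w - p) 0 := by
      simpa using ((hasDerivAt_id (0 : ℝ)).smul_const (w - p)).const_add p
    have hf' : HasFDerivAt f (InnerProductSpace.toDual ℝ H g) (p + (0 : ℝ) • (w - p)) := by
      simpa using hf.hasFDerivAt
    simpa using! hf'.comp_hasDerivAt (0 : ℝ) hl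
  have hslope := hder.hasDerivWithinAt (s := Ioi (0 : ℝ))
  rw [hasDerivWithinAt_iff_tendsto_slope' (by simp)] at hslope
  have : a - b ≤ inner ℝ g (w - p) := by
    refine ge_of_tendsto hslope ?_
    filter_upwards [Ioo_mem_nhdsGT (zero_lt_one' ℝ)] with t ht
    have h2 := hsec t ht.1 ht.2
    simp only [slope_def_field, sub_zero, zero_smul, add_zero]
    rw [le_div_iff₀ ht.1]
    linarith
  linarith

/-- The quadratic penalty in the definition of the proximity operator has the obvious gradient. -/
theorem hasGradientAt_moreau_penalty (γ : ℝ) (z p : H) :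
    HasGradientAt (fun w => 1 / (2 * γ) * ‖z - w‖ ^ 2) (γ⁻¹ • (p - z)) p := by
  have h1 : HasFDerivAt (fun w : H => z - w) (-ContinuousLinearMap.id ℝ H) p :=
    (hasFDerivAt_id p).const_sub z
  have h2 := (h1.norm_sq).const_mul (1 / (2 * γ))
  rw [hasGradientAt_iff_hasFDerivAt]
  refine h2.congr_fderiv ?_
  ext v
  simp
  ring

omit [CompleteSpace H] in
/-- Expansion of the quadratic penalty around a point. -/
theorem moreau_penalty_expand {γ : ℝ} (hγ : 0 < γ) (z p w : H) :
    1 / (2 * γ) * ‖z - w‖ ^ 2 =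
      1 / (2 * γ) * ‖z - p‖ ^ 2 - γ⁻¹ * inner ℝ (z - p) (w - p) + 1 / (2 * γ) * ‖w - p‖ ^ 2 := by
  have h1 : z - w = (z - p) - (w - p) := by abel
  rw [h1, norm_sub_sq_real]
  field_simp

/-- Variational characterization of proximal points. -/
theorem isProxPoint_iff {γ : ℝ} (hγ : 0 < γ) {φ : H → EReal} (hφ : IsProperFun φ)
    (hc : IsConvexFun φ) {z p : H} :
    IsProxPoint γ φ z p ↔
      ∃ a : ℝ, φ p = a ∧ ∀ w, ((a + γ⁻¹ * inner ℝ (z - p) (w - p) : ℝ) : EReal) ≤ φ w := by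
  constructor
  · intro hp
    obtain ⟨a, ha, hw⟩ := exists_affine_minorant_of_isMinOn_add
      (hasGradientAt_moreau_penalty γ z p) hφ hc
      (by simpa only [IsProxPoint, add_comm] using hp)
    refine ⟨a, ha, fun w => ?_⟩
    convert hw w using 2
    rw [inner_smul_left, ← neg_sub z p, inner_neg_left]
    simp
  · rintro ⟨a, ha, hw⟩ w -
    have h1 := add_le_add_left (hw w) (((1 / (2 * γ) * ‖z - w‖ ^ 2 : ℝ)) : EReal)
    refine le_trans ?_ h1
    simp only [ha]
    rw [← EReal.coe_add, ← EReal.coe_add, EReal.coe_le_coe_iff, moreau_penalty_expand hγ z p w]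
    have : 0 ≤ 1 / (2 * γ) * ‖w - p‖ ^ 2 := by positivity
    linarith

/-- Proximal points depend on their base point in a firmly nonexpansive way. -/
theorem IsProxPoint.norm_sub_le {γ : ℝ} (hγ : 0 < γ) {φ : H → EReal} (hφ : IsProperFun φ)
    (hc : IsConvexFun φ) {x y p q : H} (hp : IsProxPoint γ φ x p) (hq : IsProxPoint γ φ y q) :
    ‖p - q‖ ≤ ‖x - y‖ := by
  obtain ⟨a, ha, hpw⟩ := (isProxPoint_iff hγ hφ hc).1 hp
  obtain ⟨b, hb, hqw⟩ := (isProxPoint_iff hγ hφ hc).1 hq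
  have h1 := hpw q
  have h2 := hqw p
  rw [hb, EReal.coe_le_coe_iff] at h1
  rw [ha, EReal.coe_le_coe_iff] at h2
  have h3 : γ⁻¹ * (inner ℝ (x - p) (q - p) + inner ℝ (y - q) (p - q)) ≤ 0 := by linarith
  have h4 : inner ℝ (x - p) (q - p) + inner ℝ (y - q) (p - q) ≤ 0 := by
    by_contra! h
    have := mul_pos (inv_pos.2 hγ) h
    linarith
  have h5 : inner ℝ (x - p) (q - p) + inner ℝ (y - q) (p - q)
      = ‖p - q‖ ^ 2 - inner ℝ (x - y) (p - q) := by
    rw [← real_inner_self_eq_norm_sq, ← neg_sub p q, inner_neg_right]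
    simp only [inner_sub_left]
    ring
  have h6 := real_inner_le_norm (x - y) (p - q)
  by_contra! h
  have h7 : 0 < ‖p - q‖ := (norm_nonneg _).trans_lt h
  nlinarith

omit [CompleteSpace H] in
/-- A lower semicontinuous function with an affine minorant touching it has
proximal points. -/
theorem exists_isProxPoint [FiniteDimensional ℝ H] {γ : ℝ} (hγ : 0 < γ) {φ : H → EReal}
    (hlsc : LowerSemicontinuous φ) {s g : H} {a : ℝ} (ha : φ s = a)
    (hs : ∀ w, ((a - inner ℝ g (w - s) : ℝ) : EReal) ≤ φ w) (z : H) :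
    ∃ p, IsProxPoint γ φ z p := by
  -- Outside this radius `‖w - s‖² / 2` dominates the linear terms, at most `(‖z - s‖ + γ‖g‖)‖w -
  -- s‖`, so the objective is no smaller than at `s` and compactness of the ball suffices.
  set R : ℝ := 2 * (‖z - s‖ + γ * ‖g‖) with hR
  have hR0 : 0 ≤ R := by positivity
  have hlsc' : LowerSemicontinuous
      (fun w => φ w + ((1 / (2 * γ) * ‖z - w‖ ^ 2 : ℝ) : EReal)) := by
    refine LowerSemicontinuous.add' hlsc (Continuous.lowerSemicontinuous ?_) fun w =>
      EReal.continuousAt_add (.inr (EReal.coe_ne_bot _)) (.inr (EReal.coe_ne_top _))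
    exact continuous_coe_real_ereal.comp (by fun_prop)
  obtain ⟨p, -, hp⟩ := LowerSemicontinuousOn.exists_isMinOn
    (s := Metric.closedBall s R) ⟨s, Metric.mem_closedBall_self hR0⟩
    (isCompact_closedBall s R) (hlsc'.lowerSemicontinuousOn _)
  refine ⟨p, fun w _ => ?_⟩
  by_cases hw : w ∈ Metric.closedBall s R
  · exact hp hw
  refine le_trans (isMinOn_iff.1 hp s (Metric.mem_closedBall_self hR0)) ?_
  refine le_trans ?_ (add_le_add_left (hs w) _)
  simp only [ha]
  rw [← EReal.coe_add, ← EReal.coe_add, EReal.coe_le_coe_iff, moreau_penalty_expand hγ z s w]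
  have hd : R < ‖w - s‖ := by simpa [dist_eq_norm] using hw
  have h1 := real_inner_le_norm (z - s) (w - s)
  have h2 := real_inner_le_norm g (w - s)
  have h3 : 1 / (2 * γ) * ‖w - s‖ ^ 2 = γ⁻¹ * (‖w - s‖ ^ 2 / 2) := by field_simp
  have h4 : γ⁻¹ * (inner ℝ (z - s) (w - s) + γ * inner ℝ g (w - s)) ≤
      γ⁻¹ * (‖w - s‖ ^ 2 / 2) := by
    gcongr
    nlinarith [norm_nonneg (w - s)]
  have h5 : γ⁻¹ * (inner ℝ (z - s) (w - s) + γ * inner ℝ g (w - s)) =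
      γ⁻¹ * inner ℝ (z - s) (w - s) + inner ℝ g (w - s) := by field_simp
  linarith

variable [FiniteDimensional ℝ H] {h : H → ℝ} {φ : H → EReal} {γ η L : ℝ} {zs : H}

/-- The minimizer `zs` itself supplies the affine minorant of `φ` that makes the proximal objective
coercive, so no separation theorem is needed. -/
theorem isProxPoint_prox_of_isMinOn (hdiff : ContDiff ℝ 1 h) (hφ : IsProperFun φ)
    (hc : IsConvexFun φ) (hlsc : LowerSemicontinuous φ) (hγ : 0 < γ)
    (hzs : IsMinOn (fun z => (h z : EReal) + φ z) univ zs) (z : H) :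
    IsProxPoint γ φ z (prox γ φ z) := by
  obtain ⟨a, ha, hs⟩ := exists_affine_minorant_of_isMinOn_add
    ((hdiff.differentiable one_ne_zero) zs).hasGradientAt hφ hc hzs
  exact Classical.epsilon_spec (exists_isProxPoint hγ hlsc ha hs z)

/-- Minimizers of `h + φ` are fixed points of the forward-backward operator. -/
theorem fwdBwd_eq_self_of_isMinOn (hdiff : ContDiff ℝ 1 h) (hφ : IsProperFun φ)
    (hc : IsConvexFun φ) (hlsc : LowerSemicontinuous φ) (hγ : 0 < γ)
    (hzs : IsMinOn (fun z => (h z : EReal) + φ z) univ zs) :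
    fwdBwd γ h φ zs = zs := by
  have h1 := isProxPoint_prox_of_isMinOn hdiff hφ hc hlsc hγ hzs (zs - γ • gradient h zs)
  have h2 : IsProxPoint γ φ (zs - γ • gradient h zs) zs := by
    obtain ⟨a, ha, hs⟩ := exists_affine_minorant_of_isMinOn_add
      ((hdiff.differentiable one_ne_zero) zs).hasGradientAt hφ hc hzs
    refine (isProxPoint_iff hγ hφ hc).2 ⟨a, ha, fun w => ?_⟩
    convert hs w using 2
    rw [sub_sub_cancel_left, inner_neg_left, inner_smul_left]
    simp only [conj_trivial]
    field_simp
    ring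
  -- Nonexpansiveness with equal base points is uniqueness of the proximal point.
  have h3 := h1.norm_sub_le hγ hφ hc h2
  rw [sub_self, norm_zero] at h3
  exact sub_eq_zero.1 (norm_le_zero_iff.1 h3)

/-- The forward-backward operator is a contraction when `γ L² < 2 η`. -/
theorem exists_lipschitz_fwdBwd (hdiff : ContDiff ℝ 1 h) (hφ : IsProperFun φ)
    (hc : IsConvexFun φ) (hlsc : LowerSemicontinuous φ) (hγ : 0 < γ)
    (hzs : IsMinOn (fun z => (h z : EReal) + φ z) univ zs)
    (hmono : ∀ x y : H, η * ‖x - y‖ ^ 2 ≤ inner ℝ (gradient h x - gradient h y) (x - y))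
    (hlip : ∀ x y : H, ‖gradient h x - gradient h y‖ ≤ L * ‖x - y‖)
    (hstep : γ * L ^ 2 < 2 * η) :
    ∃ c ∈ Ioo (0 : ℝ) 1, ∀ x y : H, ‖fwdBwd γ h φ x - fwdBwd γ h φ y‖ ≤ c * ‖x - y‖ := by
  -- The first entry is the squared contraction factor `1 - 2γη + γ²L²`, which may fail to be
  -- positive; `1 / 4` is an arbitrary number in `(0, 1)` keeping `√q` strictly positive.
  set q : ℝ := max (1 - γ * (2 * η - γ * L ^ 2)) (1 / 4) with hq
  have hq0 : 0 < q := lt_max_of_lt_right (by norm_num)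
  have hq1 : q < 1 := max_lt (by nlinarith) (by norm_num)
  refine ⟨√q, ⟨Real.sqrt_pos.2 hq0, (Real.sqrt_lt' one_pos).2 (by simpa using hq1)⟩,
    fun x y => ?_⟩
  have h1 := (isProxPoint_prox_of_isMinOn hdiff hφ hc hlsc hγ hzs
    (x - γ • gradient h x)).norm_sub_le hγ hφ hc (isProxPoint_prox_of_isMinOn hdiff hφ hc hlsc hγ
      hzs (y - γ • gradient h y))
  refine h1.trans (le_of_sq_le_sq ?_ (by positivity))
  have h2 : x - γ • gradient h x - (y - γ • gradient h y)
      = (x - y) - γ • (gradient h x - gradient h y) := by module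
  rw [h2, norm_sub_sq_real, inner_smul_right, norm_smul, mul_pow, mul_pow, Real.sq_sqrt hq0.le,
    Real.norm_eq_abs, sq_abs, real_inner_comm]
  have h3 := hmono x y
  have h4 : ‖gradient h x - gradient h y‖ ^ 2 ≤ (L * ‖x - y‖) ^ 2 := by
    gcongr
    exact hlip x y
  have h5 : (1 - γ * (2 * η - γ * L ^ 2)) * ‖x - y‖ ^ 2 ≤ q * ‖x - y‖ ^ 2 := by
    gcongr
    exact le_max_left _ _
  have h6 := mul_le_mul_of_nonneg_left h3 hγ.le
  have h7 := mul_le_mul_of_nonneg_left h4 (sq_nonneg γ)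
  nlinarith

end ForwardBackward

/-! ### Carathéodory solutions and global existence for Lipschitz fields. -/

section Trajectories

variable {H : Type*} [NormedAddCommGroup H] [NormedSpace ℝ H] {V : H → H} {z : ℝ → H}

theorem IsTrajectory.continuousOn (hz : IsTrajectory V z) : ContinuousOn z (Ici 0) := by
  intro t ht
  have ht' : (0 : ℝ) ≤ t := ht
  have h1 : ContinuousOn (fun u => z 0 + ∫ s in (0 : ℝ)..u, V (z s)) (Icc 0 (t + 1)) := by
    have h2 := (hz (t + 1) (by linarith)).1
    refine continuousOn_const.add ?_
    have h3 := intervalIntegral.continuousOn_primitive_interval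
      (f := fun s => V (z s)) (μ := volume) (a := 0) (b := t + 1)
      ((intervalIntegrable_iff' (by simp)).1 h2)
    rwa [uIcc_of_le (by linarith)] at h3
  have h4 : ContinuousWithinAt z (Icc 0 (t + 1)) t :=
    (h1 t ⟨ht, by linarith⟩).congr (fun u hu => (hz u hu.1).2) (hz t ht).2
  refine h4.mono_of_mem_nhdsWithin ?_
  filter_upwards [self_mem_nhdsWithin, mem_nhdsWithin_of_mem_nhds (Iio_mem_nhds (lt_add_one t))]
    with u hu hu'
  exact ⟨hu, hu'.le⟩

theorem IsTrajectory.hasDerivAt [CompleteSpace H] (hz : IsTrajectory V z) {t : ℝ} (ht : 0 < t)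
    (hV : ContinuousAt V (z t)) : HasDerivAt z (V (z t)) t := by
  have hzt : ContinuousAt z t := hz.continuousOn.continuousAt (Ici_mem_nhds ht)
  have hmeas : StronglyMeasurableAtFilter (fun s => V (z s)) (𝓝 t) := by
    refine ⟨Ioc 0 (t + 1), Ioc_mem_nhds ht (lt_add_one t), ?_⟩
    exact (hz (t + 1) (by linarith)).1.1.aestronglyMeasurable
  have h1 := (intervalIntegral.integral_hasDerivAt_right (hz t ht.le).1 hmeas
    (ContinuousAt.comp' hV hzt)).const_add (z 0)
  refine h1.congr_of_eventuallyEq ?_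
  filter_upwards [Ioi_mem_nhds ht] with u hu
  exact (hz u (le_of_lt hu)).2

/-- Rescaling time. -/
theorem IsTrajectory.comp_mul_left (hz : IsTrajectory V z) {a : ℝ} (ha : 0 < a) :
    IsTrajectory (fun x => a • V x) (fun t => z (a * t)) := by
  intro t ht
  obtain ⟨h1, h2⟩ := hz (a * t) (by positivity)
  refine ⟨?_, ?_⟩
  · have h3 := (h1.comp_mul_left (c := a))
    rw [zero_div, mul_div_cancel_left₀ _ ha.ne'] at h3
    exact h3.smul a
  · simp only
    rw [mul_zero, h2, intervalIntegral.integral_smul,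
      intervalIntegral.integral_comp_mul_left (fun s => V (z s)) ha.ne', mul_zero,
      smul_inv_smul₀ ha.ne']

/-- With Lipschitz constant `1/2`, Picard-Lindelöf gives a lifespan of one from every starting
point, so unit pieces can be concatenated over the integers. -/
theorem exists_isTrajectory_of_lipschitz_half [CompleteSpace H] {f : H → H}
    (hf : LipschitzWith (1 / 2) f) (x₀ : H) : ∃ z : ℝ → H, IsTrajectory f z ∧ z 0 = x₀ := by
  have hloc : ∀ x : H, ∃ α : ℝ → H, α 0 = x ∧
      ∀ t ∈ Icc (0 : ℝ) 1, HasDerivWithinAt α (f (α t)) (Icc 0 1) t := by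
    intro x
    -- On the ball of radius `2‖f x‖` the field is bounded by `‖f x‖ + (1/2)(2‖f x‖) = 2‖f x‖`, so a
    -- curve cannot leave it in unit time.
    have hpl : IsPicardLindelof (fun _ : ℝ => f) (⟨0, by simp⟩ : Icc (0 : ℝ) 1) x
        (2 * ‖f x‖₊) 0 (2 * ‖f x‖₊) (1 / 2) := by
      refine ⟨fun _ _ => hf.lipschitzOnWith, fun _ _ => continuousOn_const, fun _ _ y hy => ?_,
        by simp⟩
      have h1 : ‖f y - f x‖ ≤ 1 / 2 * ‖y - x‖ := by simpa using hf.norm_sub_le y x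
      have h2 : ‖y - x‖ ≤ 2 * ‖f x‖ := by simpa [dist_eq_norm] using hy
      have h3 := norm_le_norm_add_norm_sub' (f y) (f x)
      simp only [NNReal.coe_mul, NNReal.coe_ofNat, coe_nnnorm]
      linarith
    obtain ⟨α, h0, hα⟩ := hpl.exists_eq_forall_mem_Icc_hasDerivWithinAt₀
    exact ⟨α, h0, hα⟩
  choose α hα0 hα using hloc
  let X : ℕ → H := fun n => Nat.rec x₀ (fun _ x => α x 1) n
  let z : ℝ → H := fun t => α (X ⌊t⌋₊) (t - ⌊t⌋₊)
  -- The formula also holds at the right endpoint, since the next piece starts where this one ends;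
  -- this is continuity at the joints.
  have hzn : ∀ (n : ℕ) (t : ℝ), t ∈ Icc (n : ℝ) (n + 1) → z t = α (X n) (t - n) := by
    intro n t ht
    rcases ht.2.lt_or_eq with h | h
    · have : ⌊t⌋₊ = n := (Nat.floor_eq_iff ((Nat.cast_nonneg n).trans ht.1)).2 ⟨ht.1, h⟩
      simp only [z, this]
    · have : ⌊t⌋₊ = n + 1 := by rw [h]; exact_mod_cast Nat.floor_natCast (n + 1)
      simp only [z, this]
      rw [h]
      push_cast
      rw [sub_self, hα0, add_sub_cancel_left]
  have hcont : ∀ n : ℕ, ContinuousOn z (Icc (n : ℝ) (n + 1)) := by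
    intro n
    have h1 : ContinuousOn (α (X n)) (Icc 0 1) := fun t ht => (hα (X n) t ht).continuousWithinAt
    refine ContinuousOn.congr (h1.comp (f := fun t : ℝ => t - n) (by fun_prop) ?_) (hzn n)
    intro t ht
    exact ⟨sub_nonneg.2 ht.1, by linarith [ht.2]⟩
  have hderiv : ∀ (n : ℕ), ∀ t ∈ Ioo (n : ℝ) (n + 1), HasDerivAt z (f (z t)) t := by
    intro n t ht
    have h1 : HasDerivAt (α (X n)) (f (α (X n) (t - n))) (t - n) :=
      (hα (X n) (t - n) ⟨by linarith [ht.1], by linarith [ht.2]⟩).hasDerivAt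
        (Icc_mem_nhds (by linarith [ht.1]) (by linarith [ht.2]))
    have h2 := h1.comp_sub_const t n
    rw [← hzn n t ⟨ht.1.le, ht.2.le⟩] at h2
    refine h2.congr_of_eventuallyEq ?_
    filter_upwards [Ioo_mem_nhds ht.1 ht.2] with u hu
    exact hzn n u ⟨hu.1.le, hu.2.le⟩
  have hstep : ∀ (n : ℕ) (t : ℝ), t ∈ Icc (n : ℝ) (n + 1) →
      IntervalIntegrable (fun s => f (z s)) volume n t ∧
        ∫ s in (n : ℝ)..t, f (z s) = z t - z n := by
    intro n t ht
    have hsub : Icc (n : ℝ) t ⊆ Icc (n : ℝ) (n + 1) := Icc_subset_Icc_right ht.2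
    have hint : IntervalIntegrable (fun s => f (z s)) volume n t := by
      refine ContinuousOn.intervalIntegrable ?_
      rw [uIcc_of_le ht.1]
      exact hf.continuous.comp_continuousOn ((hcont n).mono hsub)
    exact ⟨hint, intervalIntegral.integral_eq_sub_of_hasDerivAt_of_le ht.1 ((hcont n).mono hsub)
      (fun s hs => hderiv n s ⟨hs.1, hs.2.trans_le ht.2⟩) hint⟩
  have hnat : ∀ n : ℕ, IntervalIntegrable (fun s => f (z s)) volume 0 n ∧
      ∫ s in (0 : ℝ)..n, f (z s) = z n - z 0 := by
    intro n
    induction n with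
    | zero => simp
    | succ n ih =>
      obtain ⟨h1, h2⟩ := hstep n (n + 1) ⟨by linarith, le_rfl⟩
      push_cast
      refine ⟨ih.1.trans h1, ?_⟩
      rw [← intervalIntegral.integral_add_adjacent_intervals ih.1 h1, ih.2, h2]
      abel
  refine ⟨z, fun t ht => ?_, ?_⟩
  · obtain ⟨h1, h2⟩ := hstep ⌊t⌋₊ t ⟨Nat.floor_le ht, (Nat.lt_floor_add_one t).le⟩
    refine ⟨(hnat _).1.trans h1, ?_⟩
    rw [← intervalIntegral.integral_add_adjacent_intervals (hnat _).1 h1, (hnat _).2, h2]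
    abel
  · simp [z, hα0, X]

/-- Globally Lipschitz vector fields are complete in positive time. -/
theorem exists_isTrajectory_of_lipschitz [CompleteSpace H] {f : H → H} {K : ℝ≥0} (hK : 0 < K)
    (hf : LipschitzWith K f) (x₀ : H) : ∃ z : ℝ → H, IsTrajectory f z ∧ z 0 = x₀ := by
  have hK' : (0 : ℝ) < 2 * K := by positivity
  have h1 : LipschitzWith (1 / 2) (fun x => (2 * K : ℝ)⁻¹ • f x) := by
    refine LipschitzWith.of_dist_le_mul fun x y => ?_
    have h2 := hf.dist_le_mul x y
    rw [dist_smul₀, Real.norm_of_nonneg (by positivity)]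
    calc (2 * K : ℝ)⁻¹ * dist (f x) (f y) ≤ (2 * K : ℝ)⁻¹ * (K * dist x y) := by gcongr
      _ = _ := by push_cast; field_simp
  obtain ⟨z, hz, h0⟩ := exists_isTrajectory_of_lipschitz_half h1 x₀
  refine ⟨fun t => z (2 * K * t), ?_, by simpa using h0⟩
  simpa only [smul_inv_smul₀ hK'.ne'] using hz.comp_mul_left hK'

theorem settlingTime_le {H : Type*} {z : ℝ → H} {zs : H} {T : ℝ} (h : ∀ t, 0 ≤ t → T ≤ t → z t = zs) :
    settlingTime z zs ≤ ENNReal.ofReal T :=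
  iInf₂_le T.toNNReal fun t ht => h t (T.toNNReal.2.trans ht) ((Real.le_coe_toNNReal T).trans ht)

end Trajectories

/-! ### Settling times from scalar differential inequalities. -/

section SettlingBound

/-- Positive solutions of the differential inequality `W' ≤ -g(W)` only exist for times shorter
than `T`. -/
def HasSettlingBound (g : ℝ → ℝ) (T : ℝ) : Prop :=
  ∀ (W : ℝ → ℝ) (t : ℝ), 0 ≤ t → ContinuousOn W (Icc 0 t) → (∀ s ∈ Icc 0 t, 0 < W s) →
    (∀ s ∈ Ioo 0 t, ∃ w, HasDerivAt W w s ∧ w ≤ -g (W s)) → t < T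

theorem antitoneOn_Icc_of_hasDerivAt {W : ℝ → ℝ} {a b : ℝ} (hc : ContinuousOn W (Icc a b))
    (hd : ∀ s ∈ Ioo a b, ∃ w, HasDerivAt W w s ∧ w ≤ 0) : AntitoneOn W (Icc a b) := by
  refine antitoneOn_of_deriv_nonpos (convex_Icc a b) hc ?_ ?_
  · rw [interior_Icc]
    intro s hs
    obtain ⟨w, hw, -⟩ := hd s hs
    exact hw.differentiableAt.differentiableWithinAt
  · rw [interior_Icc]
    intro s hs
    obtain ⟨w, hw, hw'⟩ := hd s hs
    rwa [hw.deriv]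

/-- Along `W' ≤ -g(W)`, an antiderivative `G` of a majorant of `1 / g` measures the elapsed
time. -/
theorem elapsed_time_le {g G G' W : ℝ → ℝ} {S : Set ℝ} {a b : ℝ} (hab : a ≤ b)
    (hG : ∀ w ∈ S, HasDerivAt G (G' w) w ∧ 0 ≤ G' w ∧ 1 ≤ G' w * g w)
    (hc : ContinuousOn W (Icc a b)) (hS : MapsTo W (Icc a b) S)
    (hd : ∀ s ∈ Ioo a b, ∃ w, HasDerivAt W w s ∧ w ≤ -g (W s)) :
    b - a ≤ G (W a) - G (W b) := by
  -- The derivative is `G'(W) W' + 1 ≤ 1 - G'(W) g(W) ≤ 0`.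
  have h1 : AntitoneOn (fun t => G (W t) + t) (Icc a b) := by
    refine antitoneOn_Icc_of_hasDerivAt ?_ fun s hs => ?_
    · refine ContinuousOn.add ?_ continuousOn_id
      exact fun s hs => (hG _ (hS hs)).1.continuousAt.comp_continuousWithinAt (hc s hs)
    · obtain ⟨w, hw, hw'⟩ := hd s hs
      obtain ⟨h2, h3, h4⟩ := hG _ (hS (Ioo_subset_Icc_self hs))
      refine ⟨_, (h2.comp s hw).add (hasDerivAt_id s), ?_⟩
      nlinarith [mul_le_mul_of_nonneg_left hw' h3]
  have := h1 ⟨le_rfl, hab⟩ ⟨hab, le_rfl⟩ hab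
  simp only at this
  linarith

theorem HasSettlingBound.of_potential {g G G' : ℝ → ℝ} {T : ℝ}
    (hG : ∀ w, 0 < w → HasDerivAt G (G' w) w ∧ 0 ≤ G' w ∧ 1 ≤ G' w * g w)
    (hb : ∀ w, 0 < w → 0 < G w ∧ G w ≤ T) : HasSettlingBound g T := by
  intro W t ht hc hpos hd
  have h1 := elapsed_time_le (S := Ioi 0) ht hG hc hpos hd
  have h2 := (hb _ (hpos 0 ⟨le_rfl, ht⟩)).2
  have h3 := (hb _ (hpos t ⟨ht, le_rfl⟩)).1
  linarith

/-- The phases `W ≥ 1` and `W ≤ 1` may be estimated separately. -/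
theorem HasSettlingBound.of_two_potentials {g G₁ G₁' G₂ G₂' : ℝ → ℝ} {T₁ T₂ : ℝ}
    (hg : ∀ w, 0 < w → 0 ≤ g w)
    (hG₁ : ∀ w ∈ Ioc (0 : ℝ) 1, HasDerivAt G₁ (G₁' w) w ∧ 0 ≤ G₁' w ∧ 1 ≤ G₁' w * g w)
    (hG₂ : ∀ w ∈ Ici (1 : ℝ), HasDerivAt G₂ (G₂' w) w ∧ 0 ≤ G₂' w ∧ 1 ≤ G₂' w * g w)
    (hb₁ : ∀ w ∈ Ioc (0 : ℝ) 1, 0 < G₁ w ∧ G₁ w ≤ T₁)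
    (hb₂ : ∀ w ∈ Ici (1 : ℝ), 0 ≤ G₂ w ∧ G₂ w ≤ T₂) : HasSettlingBound g (T₁ + T₂) := by
  intro W t ht hc hpos hd
  have hanti : AntitoneOn W (Icc 0 t) := antitoneOn_Icc_of_hasDerivAt hc fun s hs => by
    obtain ⟨w, hw, hw'⟩ := hd s hs
    exact ⟨w, hw, hw'.trans (neg_nonpos.2 (hg _ (hpos s (Ioo_subset_Icc_self hs))))⟩
  have hlow : ∀ a ∈ Icc 0 t, W a ≤ 1 → t - a < T₁ := by
    intro a ha hWa
    have hsub : Icc a t ⊆ Icc 0 t := Icc_subset_Icc_left ha.1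
    have hS : MapsTo W (Icc a t) (Ioc 0 1) := fun s hs =>
      ⟨hpos s (hsub hs), (hanti ha (hsub hs) hs.1).trans hWa⟩
    have h1 := elapsed_time_le ha.2 hG₁ (hc.mono hsub) hS
      fun s hs => hd s ⟨ha.1.trans_lt hs.1, hs.2⟩
    have h2 := (hb₁ _ (hS ⟨le_rfl, ha.2⟩)).2
    have h3 := (hb₁ _ (hS ⟨ha.2, le_rfl⟩)).1
    linarith
  have hhigh : ∀ b ∈ Icc 0 t, 1 ≤ W b → b ≤ T₂ := by
    intro b hb hWb
    have hsub : Icc 0 b ⊆ Icc 0 t := Icc_subset_Icc_right hb.2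
    have hS : MapsTo W (Icc 0 b) (Ici 1) := fun s hs => hWb.trans (hanti (hsub hs) hb hs.2)
    have h1 := elapsed_time_le hb.1 hG₂ (hc.mono hsub) hS
      fun s hs => hd s ⟨hs.1, hs.2.trans_le hb.2⟩
    have h2 := (hb₂ _ (hS ⟨le_rfl, hb.1⟩)).2
    have h3 := (hb₂ _ (hS ⟨hb.1, le_rfl⟩)).1
    linarith
  have hT₁ := (hb₁ 1 ⟨one_pos, le_rfl⟩).1.trans_le (hb₁ 1 ⟨one_pos, le_rfl⟩).2
  have hT₂ := (hb₂ 1 self_mem_Ici).1.trans (hb₂ 1 self_mem_Ici).2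
  rcases le_total (W 0) 1 with h0 | h0
  · linarith [hlow 0 ⟨le_rfl, ht⟩ h0]
  rcases le_total 1 (W t) with h1 | h1
  · linarith [hhigh t ⟨ht, le_rfl⟩ h1]
  -- At a crossing time `W s = 1` both estimates apply: `s ≤ T₂` and `t - s < T₁`.
  obtain ⟨s, hs, hs1⟩ := intermediate_value_Icc' ht hc ⟨h1, h0⟩
  linarith [hlow s hs hs1.le, hhigh s hs hs1.ge]

variable {M₁ M₂ M₃ r₁ r₂ : ℝ}

/-- Below level `1` only the `r₁` term is kept, above it only the `r₂` term; the summands are `∫₀¹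
dw/(M₁w^r₁)` and `∫₁^∞ dw/(M₂w^r₂)`. -/
theorem hasSettlingBound_rpow_add_rpow (hM₁ : 0 < M₁) (hM₂ : 0 < M₂) (hr₁ : r₁ < 1)
    (hr₂ : 1 < r₂) :
    HasSettlingBound (fun w => M₁ * w ^ r₁ + M₂ * w ^ r₂)
      (1 / (M₁ * (1 - r₁)) + 1 / (M₂ * (r₂ - 1))) := by
  have h1 : 0 < 1 - r₁ := by linarith
  have h2 : 0 < r₂ - 1 := by linarith
  refine HasSettlingBound.of_two_potentials
    (G₁ := fun w => w ^ (1 - r₁) / (M₁ * (1 - r₁))) (G₁' := fun w => w ^ (-r₁) / M₁)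
    (G₂ := fun w => (1 - w ^ (1 - r₂)) / (M₂ * (r₂ - 1))) (G₂' := fun w => w ^ (-r₂) / M₂)
    (fun w hw => by positivity) ?_ ?_ ?_ ?_
  · intro w hw
    have hw0 := hw.1
    refine ⟨?_, by positivity, ?_⟩
    · refine HasDerivAt.congr_deriv ((Real.hasDerivAt_rpow_const (p := 1 - r₁) (.inl hw0.ne')).div_const
        (M₁ * (1 - r₁))) ?_
      rw [show 1 - r₁ - 1 = -r₁ by ring]
      field_simp
    · have : w ^ (-r₁) / M₁ * (M₁ * w ^ r₁) = 1 := by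
        rw [Real.rpow_neg hw0.le]; field_simp
      have : 0 ≤ w ^ (-r₁) / M₁ * (M₂ * w ^ r₂) := by positivity
      linarith
  · intro w hw
    have hw0 : 0 < w := one_pos.trans_le hw
    refine ⟨?_, by positivity, ?_⟩
    · refine HasDerivAt.congr_deriv (((Real.hasDerivAt_rpow_const (p := 1 - r₂) (.inl hw0.ne')).const_sub 1).div_const
        (M₂ * (r₂ - 1))) ?_
      rw [show 1 - r₂ - 1 = -r₂ by ring]
      field_simp
      ring
    · have : w ^ (-r₂) / M₂ * (M₂ * w ^ r₂) = 1 := by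
        rw [Real.rpow_neg hw0.le]; field_simp
      have : 0 ≤ w ^ (-r₂) / M₂ * (M₁ * w ^ r₁) := by positivity
      linarith
  · intro w hw
    have hw0 := hw.1
    refine ⟨by positivity, ?_⟩
    gcongr
    exact Real.rpow_le_one hw0.le hw.2 h1.le
  · intro w hw
    have hw0 : 0 < w := one_pos.trans_le hw
    have h3 : w ^ (1 - r₂) ≤ 1 := Real.rpow_le_one_of_one_le_of_nonpos hw (by linarith)
    have h4 : 0 ≤ w ^ (1 - r₂) := by positivity
    refine ⟨div_nonneg (by linarith) (by positivity), ?_⟩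
    gcongr
    linarith

/-- For exponents symmetric about `1`, put `β = 1/(2α)`. The substitution `s = w^β` turns the full
integral `∫ dw/g` into `2α ∫₀^∞ ds/(M₁ + M₂s²)`, with no splitting and no loss. -/
theorem hasSettlingBound_arctan {α : ℝ} (hM₁ : 0 < M₁) (hM₂ : 0 < M₂) (hα : 0 < α) :
    HasSettlingBound (fun w => M₁ * w ^ (1 - 1 / (2 * α)) + M₂ * w ^ (1 + 1 / (2 * α)))
      (Real.pi * α / √(M₁ * M₂)) := by
  obtain ⟨m, hm, hmM⟩ : ∃ m, 0 < m ∧ m ^ 2 = M₁ := ⟨√M₁, by positivity, Real.sq_sqrt hM₁.le⟩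
  obtain ⟨n, hn, hnM⟩ : ∃ n, 0 < n ∧ n ^ 2 = M₂ := ⟨√M₂, by positivity, Real.sq_sqrt hM₂.le⟩
  subst hmM hnM
  rw [← mul_pow, Real.sqrt_sq (by positivity)]
  set β := 1 / (2 * α) with hβ
  have hβ0 : 0 < β := by positivity
  have hαβ : α * β = 1 / 2 := by rw [hβ]; field_simp
  refine HasSettlingBound.of_potential
    (G := fun w => 2 * α / (m * n) * Real.arctan (n / m * w ^ β))
    (G' := fun w => 2 * α / (m * n) * (1 / (1 + (n / m * w ^ β) ^ 2) *
      (n / m * (β * w ^ (β - 1))))) ?_ ?_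
  · intro w hw
    refine ⟨?_, by positivity, le_of_eq ?_⟩
    · exact (((Real.hasDerivAt_rpow_const (.inl hw.ne')).const_mul _).arctan).const_mul _
    · have e1 : w ^ (1 - β) = w / w ^ β := by rw [Real.rpow_sub hw, Real.rpow_one]
      have e2 : w ^ (1 + β) = w * w ^ β := by rw [Real.rpow_add hw, Real.rpow_one]
      have e3 : w ^ (β - 1) = w ^ β / w := by rw [Real.rpow_sub hw, Real.rpow_one]
      simp only [e1, e2, e3]
      have hs : 0 < w ^ β := by positivity
      generalize w ^ β = s at hs ⊢
      have : α = 1 / (2 * β) := by rw [hβ]; field_simp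
      rw [this]
      field_simp
  · intro w hw
    refine ⟨mul_pos (by positivity) (Real.arctan_pos.2 (by positivity)), ?_⟩
    have h1 := (Real.arctan_lt_pi_div_two (n / m * w ^ β)).le
    calc 2 * α / (m * n) * Real.arctan (n / m * w ^ β) ≤ 2 * α / (m * n) * (Real.pi / 2) := by
          gcongr
      _ = _ := by field_simp

/-- The split at `1` keeps the linear term in both phases; with `s = w^(1 - rᵢ)` each integral
becomes `∫₀¹ ds/(Mᵢ + M₃s)` up to the factor `1/|1 - rᵢ|`, hence the logarithms. -/
theorem hasSettlingBound_rpow_add_rpow_add_linear (hM₁ : 0 < M₁) (hM₂ : 0 < M₂) (hM₃ : 0 < M₃)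
    (hr₁ : r₁ < 1) (hr₂ : 1 < r₂) :
    HasSettlingBound (fun w => M₁ * w ^ r₁ + M₂ * w ^ r₂ + M₃ * w)
      (Real.log (1 + M₃ / M₁) / (M₃ * (1 - r₁)) + Real.log (1 + M₃ / M₂) / (M₃ * (r₂ - 1))) := by
  have h1 : 0 < 1 - r₁ := by linarith
  have h2 : 0 < r₂ - 1 := by linarith
  have hlog : ∀ M, 0 < M → Real.log (1 + M₃ / M) = Real.log (M + M₃) - Real.log M := by
    intro M hM
    rw [← Real.log_div (by positivity) hM.ne', add_div, div_self hM.ne']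
  rw [hlog _ hM₁, hlog _ hM₂]
  refine HasSettlingBound.of_two_potentials
    (G₁ := fun w => (Real.log (M₁ + M₃ * w ^ (1 - r₁)) - Real.log M₁) / (M₃ * (1 - r₁)))
    (G₁' := fun w => w ^ (-r₁) / (M₁ + M₃ * w ^ (1 - r₁)))
    (G₂ := fun w => (Real.log (M₂ + M₃) - Real.log (M₂ + M₃ * w ^ (1 - r₂))) / (M₃ * (r₂ - 1)))
    (G₂' := fun w => w ^ (-r₂) / (M₂ + M₃ * w ^ (1 - r₂)))
    (fun w hw => by positivity) ?_ ?_ ?_ ?_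
  · intro w hw
    have hw0 := hw.1
    refine ⟨?_, by positivity, ?_⟩
    · refine HasDerivAt.congr_deriv ((((((Real.hasDerivAt_rpow_const (p := 1 - r₁) (.inl hw0.ne')).const_mul
        M₃).const_add M₁).log (by positivity)).sub_const (Real.log M₁)).div_const
        (M₃ * (1 - r₁))) ?_
      rw [show 1 - r₁ - 1 = -r₁ by ring]
      field_simp
    · rw [div_mul_eq_mul_div, le_div_iff₀ (by positivity), one_mul, sub_eq_neg_add,
        Real.rpow_add hw0, Real.rpow_one]
      have h3 : w ^ (-r₁) * w ^ r₁ = 1 := by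
        rw [← Real.rpow_add hw0, neg_add_cancel, Real.rpow_zero]
      have h4 : 0 ≤ w ^ (-r₁) * (M₂ * w ^ r₂) := by positivity
      linear_combination h4 - M₁ * h3
  · intro w hw
    have hw0 : 0 < w := one_pos.trans_le hw
    refine ⟨?_, by positivity, ?_⟩
    · refine HasDerivAt.congr_deriv ((((((Real.hasDerivAt_rpow_const (p := 1 - r₂) (.inl hw0.ne')).const_mul
        M₃).const_add M₂).log (by positivity)).const_sub (Real.log (M₂ + M₃))).div_const
        (M₃ * (r₂ - 1))) ?_
      rw [show 1 - r₂ - 1 = -r₂ by ring]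
      field_simp
      ring
    · rw [div_mul_eq_mul_div, le_div_iff₀ (by positivity), one_mul, sub_eq_neg_add,
        Real.rpow_add hw0, Real.rpow_one]
      have h3 : w ^ (-r₂) * w ^ r₂ = 1 := by
        rw [← Real.rpow_add hw0, neg_add_cancel, Real.rpow_zero]
      have h4 : 0 ≤ w ^ (-r₂) * (M₁ * w ^ r₁) := by positivity
      linear_combination h4 - M₂ * h3
  · intro w hw
    have hw0 := hw.1
    have h3 : w ^ (1 - r₁) ≤ 1 := Real.rpow_le_one hw0.le hw.2 h1.le
    refine ⟨div_pos (sub_pos.2 (Real.log_lt_log hM₁ ?_)) (by positivity), ?_⟩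
    · have : 0 < M₃ * w ^ (1 - r₁) := by positivity
      linarith
    · gcongr
      nlinarith
  · intro w hw
    have hw0 : 0 < w := one_pos.trans_le hw
    have h3 : w ^ (1 - r₂) ≤ 1 := Real.rpow_le_one_of_one_le_of_nonpos hw (by linarith)
    have h4 : 0 < M₃ * w ^ (1 - r₂) := by positivity
    refine ⟨div_nonneg (sub_nonneg.2 (Real.log_le_log (by positivity) ?_)) (by positivity), ?_⟩
    · nlinarith
    · gcongr
      linarith

end SettlingBound

/-! ### Energy decay, Lyapunov stability and settling of trajectories. -/

section Dissipative

variable {H : Type*} [NormedAddCommGroup H] [InnerProductSpace ℝ H] {V : H → H}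
  {z : ℝ → H} {zs : H}

theorem hasDerivAt_energy {t : ℝ} {v : H} (h : HasDerivAt z v t) :
    HasDerivAt (fun s => 1 / 2 * ‖z s - zs‖ ^ 2) (inner ℝ (z t - zs) v) t := by
  refine HasDerivAt.congr_deriv (((h.sub_const zs).norm_sq).const_mul (1 / 2)) ?_
  ring

omit [InnerProductSpace ℝ H] in
theorem energy_pos {x : H} (hx : x ≠ zs) : 0 < 1 / 2 * ‖x - zs‖ ^ 2 := by
  have := norm_pos_iff.2 (sub_ne_zero.2 hx)
  positivity

omit [InnerProductSpace ℝ H] in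
theorem ContinuousOn.energy {s : Set ℝ} (h : ContinuousOn z s) :
    ContinuousOn (fun t => 1 / 2 * ‖z t - zs‖ ^ 2) s :=
  (((h.sub continuousOn_const).norm).pow 2).const_mul _

variable [CompleteSpace H]

theorem IsTrajectory.energy_antitoneOn (hV : ∀ x, x ≠ zs → ContinuousAt V x)
    (hdis : ∀ x, inner ℝ (x - zs) (V x) ≤ 0) (hz : IsTrajectory V z) {a b : ℝ} (ha : 0 ≤ a)
    (hne : ∀ s ∈ Ioo a b, z s ≠ zs) :
    AntitoneOn (fun s => 1 / 2 * ‖z s - zs‖ ^ 2) (Icc a b) :=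
  antitoneOn_Icc_of_hasDerivAt
    (hz.continuousOn.mono fun _ hs => ha.trans hs.1).energy
    fun s hs => ⟨_, hasDerivAt_energy (hz.hasDerivAt (ha.trans_lt hs.1) (hV _ (hne s hs))),
      hdis _⟩

/-- A trajectory that has reached the equilibrium stays there. -/
theorem IsTrajectory.ne_of_ne (hV : ∀ x, x ≠ zs → ContinuousAt V x)
    (hdis : ∀ x, inner ℝ (x - zs) (V x) ≤ 0) (hz : IsTrajectory V z) {t : ℝ}
    (hzt : z t ≠ zs) : ∀ s ∈ Icc 0 t, z s ≠ zs := by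
  by_contra! hcon
  have hcl : IsCompact (Icc 0 t ∩ z ⁻¹' {zs}) :=
    isCompact_Icc.of_isClosed_subset
      ((hz.continuousOn.mono Icc_subset_Ici_self).preimage_isClosed_of_isClosed isClosed_Icc
        isClosed_singleton) inter_subset_left
  -- Take the last visit to `zs` before `t`. Afterwards the field is continuous along `z`, so the
  -- energy cannot grow from `0` to its positive value at `t`.
  obtain ⟨s, ⟨hs, hzs⟩, hmax⟩ := hcl.exists_isGreatest (by
    obtain ⟨s, hs, hzs⟩ := hcon
    exact ⟨s, hs, hzs⟩)
  have hanti := hz.energy_antitoneOn (a := s) (b := t) hV hdis hs.1 fun u hu hzu =>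
    hu.1.not_ge (hmax ⟨⟨hs.1.trans hu.1.le, hu.2.le⟩, hzu⟩)
  have h1 := hanti ⟨le_rfl, hs.2⟩ ⟨hs.2, le_rfl⟩ hs.2
  have h2 : z s = zs := hzs
  simp only [h2, sub_self, norm_zero] at h1
  have := energy_pos hzt
  norm_num at h1
  linarith

theorem IsTrajectory.norm_sub_le (hV : ∀ x, x ≠ zs → ContinuousAt V x)
    (hdis : ∀ x, inner ℝ (x - zs) (V x) ≤ 0) (hz : IsTrajectory V z) {t : ℝ} (ht : 0 ≤ t) :
    ‖z t - zs‖ ≤ ‖z 0 - zs‖ := by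
  by_cases hzt : z t = zs
  · simp [hzt]
  have h1 := hz.energy_antitoneOn (a := 0) (b := t) hV hdis le_rfl
    (fun s hs => hz.ne_of_ne hV hdis hzt s (Ioo_subset_Icc_self hs)) ⟨le_rfl, ht⟩ ⟨ht, le_rfl⟩ ht
  simp only at h1
  exact le_of_sq_le_sq (by linarith) (norm_nonneg _)

theorem isLyapunovStable_of_dissipative (hV : ∀ x, x ≠ zs → ContinuousAt V x)
    (hdis : ∀ x, inner ℝ (x - zs) (V x) ≤ 0) : IsLyapunovStable V zs := by
  refine fun ε hε => ⟨ε, hε, fun z hz h0 t ht => ?_⟩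
  rw [mem_ball_iff_norm] at h0 ⊢
  exact (hz.norm_sub_le hV hdis ht.le).trans_lt h0

/-- A trajectory not at `zs` at time `t` has avoided it throughout `[0, t]`, so its energy is a
positive solution of the inequality up to `t`, forcing `t < T`. -/
theorem HasSettlingBound.settlesWithin {g : ℝ → ℝ} {T : ℝ} (hT : HasSettlingBound g T)
    (hV : ∀ x, x ≠ zs → ContinuousAt V x) (hdis : ∀ x, inner ℝ (x - zs) (V x) ≤ 0)
    (hg : ∀ x, x ≠ zs → inner ℝ (x - zs) (V x) ≤ -g (1 / 2 * ‖x - zs‖ ^ 2)) :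
    SettlesWithin V zs T := by
  refine fun z hz => settlingTime_le fun t ht hTt => ?_
  by_contra hzt
  have hne := hz.ne_of_ne hV hdis hzt
  refine hTt.not_gt (hT (fun s => 1 / 2 * ‖z s - zs‖ ^ 2) t ht
    (hz.continuousOn.mono Icc_subset_Ici_self).energy (fun s hs => energy_pos (hne s hs))
    fun s hs => ?_)
  have hs' := hne s (Ioo_subset_Icc_self hs)
  exact ⟨_, hasDerivAt_energy (hz.hasDerivAt hs.1 (hV _ hs')), hg _ hs'⟩

end Dissipative

/-! ### Existence of solutions for a singular field by time change. -/

section Existence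

variable {H : Type*} [NormedAddCommGroup H] [InnerProductSpace ℝ H] [CompleteSpace H]
  {Φ : H → H} {κ : H → ℝ} {zs : H} {c : ℝ}

/-- Grönwall's inequality: `W s * exp(-K s)` is nonincreasing. No sign of `W` is assumed, so it also
yields lower bounds when applied to a negated energy. -/
theorem le_mul_exp_of_hasDerivAt_le {W : ℝ → ℝ} {K : ℝ} (hc : ContinuousOn W (Ici 0))
    (hd : ∀ s, 0 < s → ∃ w, HasDerivAt W w s ∧ w ≤ K * W s) {t : ℝ} (ht : 0 ≤ t) :
    W t ≤ W 0 * Real.exp (K * t) := by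
  have h1 : AntitoneOn (fun s => W s * Real.exp (-K * s)) (Icc 0 t) := by
    refine antitoneOn_Icc_of_hasDerivAt
      ((hc.mono Icc_subset_Ici_self).mul (by fun_prop)) fun s hs => ?_
    obtain ⟨w, hw, hle⟩ := hd s hs.1
    have h2 : HasDerivAt (fun s => Real.exp (-K * s)) (Real.exp (-K * s) * (-K * 1)) s :=
      ((hasDerivAt_id s).const_mul (-K)).exp
    refine ⟨_, hw.mul h2, ?_⟩
    have := mul_le_mul_of_nonneg_right hle (Real.exp_pos (-K * s)).le
    linarith
  have h3 := h1 ⟨le_rfl, ht⟩ ⟨ht, le_rfl⟩ ht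
  simp only [mul_zero, Real.exp_zero, mul_one] at h3
  have h4 := mul_le_mul_of_nonneg_right h3 (Real.exp_pos (K * t)).le
  rwa [mul_assoc, ← Real.exp_add, neg_mul, neg_add_cancel, Real.exp_zero, mul_one] at h4

omit [CompleteSpace H] in
/-- Integrability of a velocity that points towards the equilibrium within a fixed angle. -/
theorem integrableOn_of_angle {V : H → H} {z : ℝ → H} {C T : ℝ}
    (hV : ∀ x, x ≠ zs → ContinuousAt V x)
    (hangle : ∀ x, ‖V x‖ * ‖x - zs‖ ≤ -C * inner ℝ (x - zs) (V x))
    (hz : ContinuousOn z (Icc 0 T)) (hne : ∀ t ∈ Ioo 0 T, z t ≠ zs)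
    (hd : ∀ t ∈ Ioo 0 T, HasDerivAt z (V (z t)) t) :
    IntegrableOn (fun t => V (z t)) (Ioc 0 T) := by
  have hpos : ∀ t ∈ Ioo 0 T, 0 < ‖z t - zs‖ := fun t ht =>
    norm_pos_iff.2 (sub_ne_zero.2 (hne t ht))
  have hint : IntegrableOn (fun t => -C * (inner ℝ (z t - zs) (V (z t)) / ‖z t - zs‖))
      (Ioc 0 T) := by
    -- The majorant is the derivative of `-C‖z - zs‖`, nonnegative by the angle condition;
    -- continuity of the primitive up to the endpoints makes it integrable.
    refine intervalIntegral.integrableOn_deriv_of_nonneg (g := fun t => -C * ‖z t - zs‖)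
      (((hz.sub continuousOn_const).norm).const_mul _) (fun t ht => ?_) fun t ht => ?_
    · refine HasDerivAt.const_mul _ ?_
      have h1 := (((hd t ht).sub_const zs).norm_sq).sqrt (pow_pos (hpos t ht) 2).ne'
      simp only [Real.sqrt_sq (norm_nonneg _)] at h1
      refine h1.congr_deriv ?_
      rw [mul_div_mul_left _ _ two_ne_zero]
    · rw [← mul_div_assoc]
      exact div_nonneg ((by positivity : 0 ≤ ‖V (z t)‖ * ‖z t - zs‖).trans (hangle _))
        (norm_nonneg _)
  rw [integrableOn_Ioc_iff_integrableOn_Ioo] at hint ⊢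
  refine Integrable.mono' hint ?_ ?_
  · refine ContinuousOn.aestronglyMeasurable (fun t ht => ?_) measurableSet_Ioo
    exact ((hV _ (hne t ht)).comp' (hd t ht).continuousAt).continuousWithinAt
  · filter_upwards [ae_restrict_mem measurableSet_Ioo] with t ht
    rw [← mul_div_assoc, le_div_iff₀ (hpos t ht)]
    exact hangle _

/-- Trajectories of `V = -κ Φ`, for a Lipschitz field `Φ` and a positive factor `κ` which may be
singular at the equilibrium, are time changes of trajectories of `-Φ`. -/
theorem exists_isTrajectory_of_timeChange {V : H → H} {g : ℝ → ℝ} {T C m M : ℝ} {K : ℝ≥0}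
    (hT : HasSettlingBound g T) (hm : 0 < m) (hK : 0 < K) (hΦ : LipschitzWith K Φ)
    (hlow : ∀ x, m * ‖x - zs‖ ^ 2 ≤ inner ℝ (x - zs) (Φ x))
    (hup : ∀ x, inner ℝ (x - zs) (Φ x) ≤ M * ‖x - zs‖ ^ 2)
    (hκ : ∀ x, x ≠ zs → ContinuousAt κ x) (hκ0 : ∀ x, x ≠ zs → 0 < κ x)
    (hVdef : ∀ x, V x = -κ x • Φ x) (hV0 : V zs = 0)
    (hangle : ∀ x, ‖V x‖ * ‖x - zs‖ ≤ -C * inner ℝ (x - zs) (V x))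
    (hg : ∀ x, x ≠ zs → inner ℝ (x - zs) (V x) ≤ -g (1 / 2 * ‖x - zs‖ ^ 2)) (z₀ : H) :
    ∃ z : ℝ → H, IsTrajectory V z ∧ z 0 = z₀ := by
  by_cases hz₀ : z₀ = zs
  · exact ⟨fun _ => zs, fun t _ => by simp [hV0], hz₀.symm⟩
  have hV : ∀ x, x ≠ zs → ContinuousAt V x := fun x hx => by
    have h1 : V = fun x => -κ x • Φ x := funext hVdef
    rw [h1]
    exact (hκ x hx).neg.smul hΦ.continuous.continuousAt
  obtain ⟨y, hy, hy0⟩ := exists_isTrajectory_of_lipschitz (f := fun x => -Φ x) hK hΦ.neg z₀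
  have hyc := hy.continuousOn
  have hyd : ∀ t, 0 < t → HasDerivAt y (-Φ (y t)) t := fun t ht =>
    hy.hasDerivAt ht hΦ.continuous.neg.continuousAt
  -- the energy decays exponentially, but does not vanish
  have hne : ∀ t, 0 ≤ t → y t ≠ zs := by
    intro t ht hyt
    have h1 := le_mul_exp_of_hasDerivAt_le (W := fun s => -(1 / 2 * ‖y s - zs‖ ^ 2))
      (K := -(2 * M)) (hyc.energy.neg) (fun s hs => ⟨_, (hasDerivAt_energy (hyd s hs)).neg, by
        rw [inner_neg_right]
        linarith [hup (y s)]⟩) ht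
    have h2 := energy_pos (zs := zs) (x := y 0) (by rwa [hy0])
    have h3 := mul_pos h2 (Real.exp_pos (-(2 * M) * t))
    simp only [hyt, sub_self, norm_zero] at h1
    norm_num at h1 h3
    linarith
  have hlim : Tendsto (fun t => 1 / 2 * ‖y t - zs‖ ^ 2) atTop (𝓝 0) := by
    have h1 : ∀ t, 0 ≤ t → 1 / 2 * ‖y t - zs‖ ^ 2 ≤
        1 / 2 * ‖y 0 - zs‖ ^ 2 * Real.exp (-(2 * m) * t) := fun t ht =>
      le_mul_exp_of_hasDerivAt_le hyc.energy (fun s hs => ⟨_, hasDerivAt_energy (hyd s hs), by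
        rw [inner_neg_right]
        linarith [hlow (y s)]⟩) ht
    have h2 : Tendsto (fun t => 1 / 2 * ‖y 0 - zs‖ ^ 2 * Real.exp (-(2 * m) * t)) atTop (𝓝 0) := by
      have h3 : Tendsto (fun t => -(2 * m) * t) atTop atBot :=
        tendsto_id.const_mul_atTop_of_neg (by linarith)
      simpa using (Real.tendsto_exp_atBot.comp h3).const_mul (1 / 2 * ‖y 0 - zs‖ ^ 2)
    refine squeeze_zero' (Eventually.of_forall fun t => by positivity) ?_ h2
    filter_upwards [eventually_ge_atTop 0] with t ht using h1 t ht
  -- the new time as a function of the old one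
  set u : ℝ → H := fun t => y (max t 0) with hu
  have huc : Continuous u := by
    rw [← continuousOn_univ]
    exact hyc.comp (by fun_prop) fun t _ => le_max_right t 0
  have hune : ∀ t, u t ≠ zs := fun t => hne _ (le_max_right t 0)
  have hu0 : u 0 = z₀ := by simp [hu, hy0]
  have hud : ∀ t, 0 < t → HasDerivAt u (-Φ (u t)) t := fun t ht => by
    have h1 : u t = y t := by simp [hu, ht.le]
    rw [h1]
    refine (hyd t ht).congr_of_eventuallyEq ?_
    filter_upwards [Ioi_mem_nhds ht] with s hs
    simp [hu, (mem_Ioi.1 hs).le]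
  have hρc : Continuous fun t => (κ (u t))⁻¹ := continuous_iff_continuousAt.2 fun t =>
    ((hκ _ (hune t)).comp' huc.continuousAt).inv₀ (hκ0 _ (hune t)).ne'
  -- New time runs by `dS = dt/κ(u)`, so `u ∘ S⁻¹` has velocity `-κΦ = V`. Freezing `y` at negative
  -- times makes `S` a strictly increasing `C¹` function on the whole line.
  set S : ℝ → ℝ := fun t => ∫ s in (0 : ℝ)..t, (κ (u s))⁻¹ with hS
  have hSd : ∀ t, HasStrictDerivAt S (κ (u t))⁻¹ t := fun t =>
    hρc.integral_hasStrictDerivAt 0 t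
  have hSc : Continuous S := continuous_iff_continuousAt.2 fun t => (hSd t).hasDerivAt.continuousAt
  have hSmono : StrictMono S := strictMono_of_deriv_pos fun t => by
    rw [(hSd t).hasDerivAt.deriv]
    exact inv_pos.2 (hκ0 _ (hune t))
  have hS0 : S 0 = 0 := by simp [hS]
  set σ : ℝ → ℝ := Function.invFun S with hσ
  have hσS : ∀ t, σ (S t) = t := Function.leftInverse_invFun hSmono.injective
  have hσd : ∀ t, HasDerivAt σ (κ (u t)) (S t) := fun t => by
    have h1 := (hSd t).to_local_left_inverse (inv_pos.2 (hκ0 _ (hune t))).ne'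
      (Eventually.of_forall hσS)
    simpa using h1.hasDerivAt
  have huσc : ∀ t, ContinuousAt (fun r => u (σ r)) (S t) := fun t =>
    huc.continuousAt.comp' (hσd t).continuousAt
  have huσd : ∀ t, 0 < t → HasDerivAt (fun r => u (σ r)) (V (u t)) (S t) := fun t ht => by
    have h1 : HasDerivAt u (-Φ (u t)) (σ (S t)) := by rw [hσS]; exact hud t ht
    have h2 := h1.scomp (S t) (hσd t)
    rw [hVdef, neg_smul, ← smul_neg]
    exact h2
  have hIVT : ∀ b, 0 ≤ b → ∀ t ∈ Icc 0 (S b), ∃ a ∈ Icc 0 b, S a = t := fun b hb t ht =>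
    intermediate_value_Icc hb hSc.continuousOn (by rwa [hS0])
  -- the new time is bounded
  have hSbdd : ∀ b, 0 ≤ b → S b < T := by
    intro b hb
    refine hT (fun r => 1 / 2 * ‖u (σ r) - zs‖ ^ 2) (S b) (hS0 ▸ hSmono.monotone hb)
      (ContinuousOn.energy fun t ht => ?_) (fun t ht => energy_pos (hune _)) fun t ht => ?_
    · obtain ⟨a, ha, rfl⟩ := hIVT b hb t ht
      exact (huσc a).continuousWithinAt
    · obtain ⟨a, ha, rfl⟩ := hIVT b hb t (Ioo_subset_Icc_self ht)
      have ha0 : 0 < a := hSmono.lt_iff_lt.1 (by rw [hS0]; exact ht.1)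
      refine ⟨_, hasDerivAt_energy (huσd a ha0), ?_⟩
      rw [hσS]
      exact hg _ (hune a)
  have hbdd : BddAbove (range S) := ⟨T, by
    rintro _ ⟨t, rfl⟩
    exact (hSmono.monotone (le_max_left t 0)).trans (hSbdd _ (le_max_right t 0)).le⟩
  -- This is the arrival time, the image of old time `∞`; strict monotonicity of `S` keeps it from
  -- being attained.
  set Ts : ℝ := ⨆ t, S t with hTs
  have hSlt : ∀ t, S t < Ts := fun t =>
    (hSmono (lt_add_one t)).trans_le (le_ciSup hbdd (t + 1))
  have hTs0 : 0 < Ts := hS0 ▸ hSlt 0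
  have hsurj : ∀ t, 0 ≤ t → t < Ts → ∃ a, 0 ≤ a ∧ S a = t := by
    intro t ht0 ht
    obtain ⟨b, hb⟩ := exists_lt_of_lt_ciSup ht
    have hb0 : 0 ≤ b := hSmono.le_iff_le.1 (by rw [hS0]; exact ht0.trans hb.le)
    obtain ⟨a, ha, hat⟩ := hIVT b hb0 t ⟨ht0, hb.le⟩
    exact ⟨a, ha.1, hat⟩
  -- the reparametrized curve
  set z : ℝ → H := fun t => if t < Ts then u (σ t) else zs with hz
  have hz_lt : ∀ t, t < Ts → z =ᶠ[𝓝 t] fun r => u (σ r) := fun t ht => by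
    filter_upwards [Iio_mem_nhds ht] with r hr
    exact if_pos hr
  have hzS : ∀ t, z (S t) = u t := fun t => by simp [hz, hSlt t, hσS]
  have hz_ge : ∀ t, Ts ≤ t → z t = zs := fun t ht => if_neg ht.not_gt
  have hzd : ∀ t ∈ Ioo 0 Ts, HasDerivAt z (V (z t)) t := by
    intro t ht
    obtain ⟨a, ha, rfl⟩ := hsurj t ht.1.le ht.2
    have ha0 : 0 < a := hSmono.lt_iff_lt.1 (by rw [hS0]; exact ht.1)
    rw [hzS]
    exact (huσd a ha0).congr_of_eventuallyEq (hz_lt _ ht.2)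
  -- Approaching `Ts` from the left means old time tending to `∞`, where `y → zs` by `hlim`.
  have hzTs : ContinuousAt z Ts := by
    rw [ContinuousAt, hz_ge Ts le_rfl, Metric.tendsto_nhds]
    intro ε hε
    obtain ⟨b, hb⟩ := ((hlim.eventually (gt_mem_nhds
      (show 0 < 1 / 2 * ε ^ 2 by positivity))).and (eventually_ge_atTop 0)).exists_forall_of_atTop
    have hb0 := (hb b le_rfl).2
    filter_upwards [Ioi_mem_nhds (hSlt b)] with t ht
    by_cases htT : t < Ts
    · obtain ⟨a, ha, rfl⟩ := hsurj t ((hS0 ▸ hSmono.monotone hb0 : 0 ≤ S b).trans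
        (le_of_lt ht)) htT
      have hab : b ≤ a := (hSmono.lt_iff_lt.1 ht).le
      rw [hzS, dist_eq_norm]
      have h1 := (hb a hab).1
      have h2 : u a = y a := by simp [hu, ha]
      rw [h2]
      exact lt_of_pow_lt_pow_left₀ 2 hε.le (by linarith)
    · rw [hz_ge t (not_lt.1 htT), dist_self]
      exact hε
  have hzc : ContinuousOn z (Ici 0) := by
    intro t ht
    refine ContinuousAt.continuousWithinAt ?_
    rcases lt_trichotomy t Ts with h | h | h
    · obtain ⟨a, ha, rfl⟩ := hsurj t ht h
      exact (huσc a).congr (hz_lt _ h).symm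
    · rw [h]; exact hzTs
    · refine (continuousAt_const (y := zs)).congr ?_
      filter_upwards [Ioi_mem_nhds h] with r hr
      exact (hz_ge r (le_of_lt hr)).symm
  have hint : IntegrableOn (fun t => V (z t)) (Ioi 0) := by
    rw [← Ioc_union_Ioi_eq_Ioi hTs0.le]
    refine IntegrableOn.union (integrableOn_of_angle hV hangle (hzc.mono Icc_subset_Ici_self)
      (fun t ht => ?_) hzd) ?_
    · obtain ⟨a, ha, rfl⟩ := hsurj t ht.1.le ht.2
      rw [hzS]
      exact hune a
    · refine integrableOn_zero.congr_fun (fun t ht => ?_) measurableSet_Ioi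
      simp [hz_ge t (le_of_lt ht), hV0]
  refine ⟨z, fun t ht => ?_, by rw [← hS0, hzS, hu0]⟩
  have hint' : IntervalIntegrable (fun s => V (z s)) volume 0 t := by
    rw [intervalIntegrable_iff_integrableOn_Ioc_of_le ht]
    exact hint.mono_set Ioc_subset_Ioi_self
  refine ⟨hint', ?_⟩
  -- Differentiability may fail at the single time `Ts`, which the fundamental theorem tolerates
  -- given continuity and integrability.
  rw [MeasureTheory.integral_eq_of_hasDerivAt_off_countable_of_le z (fun s => V (z s)) ht
    (countable_singleton Ts) (hzc.mono Icc_subset_Ici_self) (fun s hs => ?_) hint']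
  · abel
  · rcases lt_or_gt_of_ne hs.2 with h | h
    · exact hzd s ⟨hs.1.1, h⟩
    · rw [hz_ge s (le_of_lt h), hV0]
      refine (hasDerivAt_const s zs).congr_of_eventuallyEq ?_
      filter_upwards [Ioi_mem_nhds h] with r hr
      exact hz_ge r (le_of_lt hr)

end Existence

/-! ### Comparison of the powers in `ω` with powers of the energy. -/

section Rates

variable {b p c ρ N : ℝ}

theorem two_rpow_mul_half_sq_rpow (hρ : 0 < ρ) (r : ℝ) :
    (2 : ℝ) ^ r * (1 / 2 * ρ ^ 2) ^ r = ρ ^ (2 * r) := by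
  rw [← Real.mul_rpow (by positivity) (by positivity), Real.rpow_mul hρ.le, Real.rpow_two]
  congr 1
  ring

/-- For `p < 1` the factor `1/N^(1 - p)` decreases in `N`, so the upper residual bound is the
relevant one; `2^((1 + p)/2)` undoes the `1/2` in the energy. -/
theorem sublinear_rate_le (hb : 0 < b) (hp : p < 1) (hc : c ∈ Ioo (0 : ℝ) 1) (hρ : 0 < ρ)
    (hN : 0 < N) (hNρ : N ≤ (1 + c) * ρ) :
    (2 : ℝ) ^ ((1 + p) / 2) * (b * (1 - c) / (1 + c) ^ (1 - p)) *
      (1 / 2 * ρ ^ 2) ^ ((1 + p) / 2) ≤ b * (1 / N ^ (1 - p)) * ((1 - c) * ρ ^ 2) := by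
  have h1c : 0 < 1 - c := sub_pos.2 hc.2
  have hc1 : 0 < 1 + c := by linarith [hc.1]
  have h1 : N ^ (1 - p) ≤ ((1 + c) * ρ) ^ (1 - p) :=
    Real.rpow_le_rpow hN.le hNρ (by linarith)
  have h2 : ρ ^ (2 * ((1 + p) / 2)) = ρ ^ 2 / ρ ^ (1 - p) := by
    rw [show 2 * ((1 + p) / 2) = 2 - (1 - p) by ring, Real.rpow_sub hρ, Real.rpow_two]
  calc _ = b * (1 - c) / (1 + c) ^ (1 - p) *
        ((2 : ℝ) ^ ((1 + p) / 2) * (1 / 2 * ρ ^ 2) ^ ((1 + p) / 2)) := by ring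
    _ = b * (1 / ((1 + c) * ρ) ^ (1 - p)) * ((1 - c) * ρ ^ 2) := by
        rw [two_rpow_mul_half_sq_rpow hρ, h2, Real.mul_rpow hc1.le hρ.le]
        field_simp
    _ ≤ _ := by gcongr

/-- For `p > 1` the factor equals the increasing `N^(p - 1)`, so the lower residual bound enters. It
contributes `(1 - c)^(p - 1)`; the last factor `1 - c` comes from the inner product. -/
theorem superlinear_rate_le (hb : 0 < b) (hp : 1 < p) (hc : c ∈ Ioo (0 : ℝ) 1) (hρ : 0 < ρ)
    (hN : 0 < N) (hNρ : (1 - c) * ρ ≤ N) :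
    (2 : ℝ) ^ ((1 + p) / 2) * ((1 - c) ^ p * b) *
      (1 / 2 * ρ ^ 2) ^ ((1 + p) / 2) ≤ b * (1 / N ^ (1 - p)) * ((1 - c) * ρ ^ 2) := by
  have h1c : 0 < 1 - c := sub_pos.2 hc.2
  have h1 : ((1 - c) * ρ) ^ (p - 1) ≤ N ^ (p - 1) :=
    Real.rpow_le_rpow (by positivity) hNρ (by linarith)
  have h2 : ρ ^ (2 * ((1 + p) / 2)) = ρ ^ (p - 1) * ρ ^ 2 := by
    rw [show 2 * ((1 + p) / 2) = (p - 1) + 2 by ring, Real.rpow_add hρ, Real.rpow_two]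
  have h3 : (1 - c) ^ p = (1 - c) ^ (p - 1) * (1 - c) := by
    rw [Real.rpow_sub_one h1c.ne']
    field_simp
  have h4 : 1 / N ^ (1 - p) = N ^ (p - 1) := by
    rw [one_div, ← Real.rpow_neg hN.le, neg_sub]
  calc _ = (1 - c) ^ p * b *
        ((2 : ℝ) ^ ((1 + p) / 2) * (1 / 2 * ρ ^ 2) ^ ((1 + p) / 2)) := by ring
    _ = b * ((1 - c) * ρ) ^ (p - 1) * ((1 - c) * ρ ^ 2) := by
        rw [two_rpow_mul_half_sq_rpow hρ, h2, h3, Real.mul_rpow h1c.le hρ.le]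
        ring
    _ ≤ _ := by rw [h4]; gcongr

end Rates

/-! ### Residual estimates, stability of the field and the predefined gain. -/

section Residual

variable {H : Type*} [NormedAddCommGroup H] [InnerProductSpace ℝ H]
  {Φ : H → H} {zs : H} {c b₁ b₂ b₃ p₁ p₂ p₃ Kp Tp : ℝ}

omit [InnerProductSpace ℝ H] in
theorem norm_sub_residual_le (hΦ0 : Φ zs = 0)
    (hΦ : ∀ x y, ‖(x - Φ x) - (y - Φ y)‖ ≤ c * ‖x - y‖) (x : H) :
    ‖(x - zs) - Φ x‖ ≤ c * ‖x - zs‖ := by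
  have h1 := hΦ x zs
  rwa [hΦ0, sub_zero, sub_right_comm] at h1

omit [InnerProductSpace ℝ H] in
theorem residual_norm_ge (hΦ0 : Φ zs = 0)
    (hΦ : ∀ x y, ‖(x - Φ x) - (y - Φ y)‖ ≤ c * ‖x - y‖) (x : H) :
    (1 - c) * ‖x - zs‖ ≤ ‖Φ x‖ := by
  have h1 := norm_sub_residual_le hΦ0 hΦ x
  have h2 := norm_sub_norm_le (x - zs) (Φ x)
  linarith

omit [InnerProductSpace ℝ H] in
theorem residual_norm_le (hΦ0 : Φ zs = 0)
    (hΦ : ∀ x y, ‖(x - Φ x) - (y - Φ y)‖ ≤ c * ‖x - y‖) (x : H) :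
    ‖Φ x‖ ≤ (1 + c) * ‖x - zs‖ := by
  have h1 := norm_sub_residual_le hΦ0 hΦ x
  have h2 := norm_sub_norm_le (Φ x) (x - zs)
  rw [norm_sub_rev (Φ x)] at h2
  linarith

/-- Cauchy-Schwarz applied to `⟪x - zs, B x - B zs⟫`, where `B x = x - Φ x`. -/
theorem le_inner_residual (hΦ0 : Φ zs = 0)
    (hΦ : ∀ x y, ‖(x - Φ x) - (y - Φ y)‖ ≤ c * ‖x - y‖) (x : H) :
    (1 - c) * ‖x - zs‖ ^ 2 ≤ inner ℝ (x - zs) (Φ x) := by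
  have h1 := norm_sub_residual_le hΦ0 hΦ x
  have h2 := real_inner_le_norm (x - zs) ((x - zs) - Φ x)
  rw [inner_sub_right, real_inner_self_eq_norm_sq] at h2
  nlinarith [mul_le_mul_of_nonneg_left h1 (norm_nonneg (x - zs))]

/-- Caps the decay rate of the flow of `-Φ`, so that it never reaches `zs` in finite time. -/
theorem inner_residual_le (hΦ0 : Φ zs = 0)
    (hΦ : ∀ x y, ‖(x - Φ x) - (y - Φ y)‖ ≤ c * ‖x - y‖) (x : H) :
    inner ℝ (x - zs) (Φ x) ≤ (1 + c) * ‖x - zs‖ ^ 2 := by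
  have h1 := residual_norm_le hΦ0 hΦ x
  have h2 := real_inner_le_norm (x - zs) (Φ x)
  nlinarith [mul_le_mul_of_nonneg_left h1 (norm_nonneg (x - zs))]

omit [InnerProductSpace ℝ H] in
theorem residual_ne_zero (hc : c < 1) (hΦ0 : Φ zs = 0)
    (hΦ : ∀ x y, ‖(x - Φ x) - (y - Φ y)‖ ≤ c * ‖x - y‖) {x : H} (hx : x ≠ zs) : Φ x ≠ 0 := by
  have h1 := residual_norm_ge hΦ0 hΦ x
  have h2 := mul_pos (sub_pos.2 hc) (norm_pos_iff.2 (sub_ne_zero.2 hx))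
  exact norm_pos_iff.1 (h2.trans_le h1)

omit [InnerProductSpace ℝ H] in
theorem lipschitzWith_residual (hc : 0 ≤ c)
    (hΦ : ∀ x y, ‖(x - Φ x) - (y - Φ y)‖ ≤ c * ‖x - y‖) :
    LipschitzWith ⟨1 + c, by positivity⟩ Φ := by
  refine LipschitzWith.of_dist_le_mul fun x y => ?_
  rw [dist_eq_norm, dist_eq_norm]
  have h1 : Φ x - Φ y = (x - y) - ((x - Φ x) - (y - Φ y)) := by abel
  have h2 := norm_sub_le (x - y) ((x - Φ x) - (y - Φ y))
  have h3 := hΦ x y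
  rw [h1]
  change _ ≤ (1 + c) * ‖x - y‖
  linarith

omit [InnerProductSpace ℝ H] in
theorem continuousAt_omegaFactor {x : H} (hΦ : Continuous Φ) (hx : Φ x ≠ 0) :
    ContinuousAt (omegaFactor Φ b₁ b₂ b₃ p₁ p₂ p₃) x := by
  have hN : ‖Φ x‖ ≠ 0 := norm_ne_zero_iff.2 hx
  have hpow : ∀ p : ℝ, ContinuousAt (fun y => 1 / ‖Φ y‖ ^ p) x := fun p =>
    continuousAt_const.div (hΦ.norm.continuousAt.rpow_const (.inl hN))
      (Real.rpow_pos_of_pos (norm_pos_iff.2 hx) p).ne'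
  have h1 : ContinuousAt (fun y => b₁ * (1 / ‖Φ y‖ ^ (1 - p₁)) + b₂ * (1 / ‖Φ y‖ ^ (1 - p₂)) +
      b₃ * (1 / ‖Φ y‖ ^ p₃)) x :=
    (((hpow _).const_mul _).add ((hpow _).const_mul _)).add ((hpow _).const_mul _)
  refine h1.congr ?_
  filter_upwards [hΦ.continuousAt.eventually_ne hx] with y hy
  rw [omegaFactor, if_neg hy]

omit [InnerProductSpace ℝ H] in
theorem omegaFactor_pos (hb₁ : 0 < b₁) (hb₂ : 0 < b₂) (hb₃ : 0 < b₃) {x : H} (hx : Φ x ≠ 0) :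
    0 < omegaFactor Φ b₁ b₂ b₃ p₁ p₂ p₃ x := by
  have := norm_pos_iff.2 hx
  rw [omegaFactor, if_neg hx]
  positivity

omit [InnerProductSpace ℝ H] in
theorem omegaFactor_nonneg (hb₁ : 0 < b₁) (hb₂ : 0 < b₂) (hb₃ : 0 < b₃) (x : H) :
    0 ≤ omegaFactor Φ b₁ b₂ b₃ p₁ p₂ p₃ x := by
  by_cases hx : Φ x = 0
  · rw [omegaFactor, if_pos hx]
  · exact (omegaFactor_pos hb₁ hb₂ hb₃ hx).le

theorem continuousAt_fieldRHS {x : H} (hΦ : Continuous Φ) (hx : Φ x ≠ 0) :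
    ContinuousAt (fieldRHS Φ b₁ b₂ b₃ p₁ p₂ p₃ Kp Tp) x :=
  ((continuousAt_omegaFactor hΦ hx).const_mul _).smul hΦ.continuousAt

theorem inner_fieldRHS_le (hk : 0 < Kp / Tp) (hb₁ : 0 < b₁) (hb₂ : 0 < b₂) (hb₃ : 0 < b₃)
    (hΦ0 : Φ zs = 0) (hΦ : ∀ x y, ‖(x - Φ x) - (y - Φ y)‖ ≤ c * ‖x - y‖) (x : H) :
    inner ℝ (x - zs) (fieldRHS Φ b₁ b₂ b₃ p₁ p₂ p₃ Kp Tp x) ≤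
      -(Kp / Tp * (omegaFactor Φ b₁ b₂ b₃ p₁ p₂ p₃ x * ((1 - c) * ‖x - zs‖ ^ 2))) := by
  have h1 := mul_le_mul_of_nonneg_left (le_inner_residual hΦ0 hΦ x)
    (mul_nonneg hk.le (omegaFactor_nonneg (Φ := Φ) (p₁ := p₁) (p₂ := p₂) (p₃ := p₃)
      hb₁ hb₂ hb₃ x))
  rw [fieldRHS, inner_smul_right]
  linarith

theorem inner_fieldRHS_nonpos (hc : c < 1) (hk : 0 < Kp / Tp) (hb₁ : 0 < b₁) (hb₂ : 0 < b₂)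
    (hb₃ : 0 < b₃) (hΦ0 : Φ zs = 0) (hΦ : ∀ x y, ‖(x - Φ x) - (y - Φ y)‖ ≤ c * ‖x - y‖) (x : H) :
    inner ℝ (x - zs) (fieldRHS Φ b₁ b₂ b₃ p₁ p₂ p₃ Kp Tp x) ≤ 0 := by
  refine (inner_fieldRHS_le hk hb₁ hb₂ hb₃ hΦ0 hΦ x).trans (neg_nonpos.2 ?_)
  have h1 := omegaFactor_nonneg (Φ := Φ) (p₁ := p₁) (p₂ := p₂) (p₃ := p₃) hb₁ hb₂ hb₃ x
  have h2 := sub_pos.2 hc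
  positivity

omit [InnerProductSpace ℝ H] in
-- The `b₃` term is carried along exactly: it is discarded for general `p₃` and becomes linear in
-- the energy for `p₃ = 0`.
theorem rate_add_le_omegaFactor (hc : c ∈ Ioo (0 : ℝ) 1) (hk : 0 < Kp / Tp) (hb₁ : 0 < b₁)
    (hb₂ : 0 < b₂) (hp₁ : p₁ < 1) (hp₂ : 1 < p₂) (hΦ0 : Φ zs = 0)
    (hΦ : ∀ x y, ‖(x - Φ x) - (y - Φ y)‖ ≤ c * ‖x - y‖) {x : H} (hx : x ≠ zs) :
    boundM₁ b₁ p₁ c Kp Tp * (1 / 2 * ‖x - zs‖ ^ 2) ^ ((1 + p₁) / 2) +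
        boundM₂ b₂ p₂ c Kp Tp * (1 / 2 * ‖x - zs‖ ^ 2) ^ ((1 + p₂) / 2) +
        Kp / Tp * (b₃ * (1 / ‖Φ x‖ ^ p₃) * ((1 - c) * ‖x - zs‖ ^ 2)) ≤
      Kp / Tp * (omegaFactor Φ b₁ b₂ b₃ p₁ p₂ p₃ x * ((1 - c) * ‖x - zs‖ ^ 2)) := by
  have hρ := norm_pos_iff.2 (sub_ne_zero.2 hx)
  have hΦx := residual_ne_zero hc.2 hΦ0 hΦ hx
  have hN := norm_pos_iff.2 hΦx
  have h1 := mul_le_mul_of_nonneg_left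
    (sublinear_rate_le hb₁ hp₁ hc hρ hN (residual_norm_le hΦ0 hΦ x)) hk.le
  have h2 := mul_le_mul_of_nonneg_left
    (superlinear_rate_le hb₂ hp₂ hc hρ hN (residual_norm_ge hΦ0 hΦ x)) hk.le
  rw [omegaFactor, if_neg hΦx, boundM₁, boundM₂]
  linarith

theorem inner_fieldRHS_le_rpow (hc : c ∈ Ioo (0 : ℝ) 1) (hk : 0 < Kp / Tp) (hb₁ : 0 < b₁)
    (hb₂ : 0 < b₂) (hb₃ : 0 < b₃) (hp₁ : p₁ < 1) (hp₂ : 1 < p₂) (hΦ0 : Φ zs = 0)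
    (hΦ : ∀ x y, ‖(x - Φ x) - (y - Φ y)‖ ≤ c * ‖x - y‖) {x : H} (hx : x ≠ zs) :
    inner ℝ (x - zs) (fieldRHS Φ b₁ b₂ b₃ p₁ p₂ p₃ Kp Tp x) ≤
      -(boundM₁ b₁ p₁ c Kp Tp * (1 / 2 * ‖x - zs‖ ^ 2) ^ ((1 + p₁) / 2) +
        boundM₂ b₂ p₂ c Kp Tp * (1 / 2 * ‖x - zs‖ ^ 2) ^ ((1 + p₂) / 2)) := by
  have h1 := rate_add_le_omegaFactor (b₃ := b₃) (p₃ := p₃) hc hk hb₁ hb₂ hp₁ hp₂ hΦ0 hΦ hx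
  have h2 := sub_pos.2 hc.2
  have h3 : 0 ≤ Kp / Tp * (b₃ * (1 / ‖Φ x‖ ^ p₃) * ((1 - c) * ‖x - zs‖ ^ 2)) := by positivity
  linarith [inner_fieldRHS_le (p₁ := p₁) (p₂ := p₂) (p₃ := p₃) hk hb₁ hb₂ hb₃ hΦ0 hΦ x]

theorem inner_fieldRHS_le_rpow_add_linear (hc : c ∈ Ioo (0 : ℝ) 1) (hk : 0 < Kp / Tp)
    (hb₁ : 0 < b₁) (hb₂ : 0 < b₂) (hb₃ : 0 < b₃) (hp₁ : p₁ < 1) (hp₂ : 1 < p₂) (hΦ0 : Φ zs = 0)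
    (hΦ : ∀ x y, ‖(x - Φ x) - (y - Φ y)‖ ≤ c * ‖x - y‖) {x : H} (hx : x ≠ zs) :
    inner ℝ (x - zs) (fieldRHS Φ b₁ b₂ b₃ p₁ p₂ 0 Kp Tp x) ≤
      -(boundM₁ b₁ p₁ c Kp Tp * (1 / 2 * ‖x - zs‖ ^ 2) ^ ((1 + p₁) / 2) +
        boundM₂ b₂ p₂ c Kp Tp * (1 / 2 * ‖x - zs‖ ^ 2) ^ ((1 + p₂) / 2) +
        2 * (Kp / Tp) * (b₃ * (1 - c)) * (1 / 2 * ‖x - zs‖ ^ 2)) := by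
  have h1 := rate_add_le_omegaFactor (b₃ := b₃) (p₃ := 0) hc hk hb₁ hb₂ hp₁ hp₂ hΦ0 hΦ hx
  rw [Real.rpow_zero] at h1
  linarith [inner_fieldRHS_le (p₁ := p₁) (p₂ := p₂) (p₃ := 0) hk hb₁ hb₂ hb₃ hΦ0 hΦ x]

/-- The scalar factor occurs on both sides, so the angle bound is that of `Φ` alone and survives any
singularity of `ω`. -/
theorem norm_fieldRHS_mul_le (hc : c ∈ Ioo (0 : ℝ) 1) (hk : 0 < Kp / Tp) (hb₁ : 0 < b₁)
    (hb₂ : 0 < b₂) (hb₃ : 0 < b₃) (hΦ0 : Φ zs = 0)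
    (hΦ : ∀ x y, ‖(x - Φ x) - (y - Φ y)‖ ≤ c * ‖x - y‖) (x : H) :
    ‖fieldRHS Φ b₁ b₂ b₃ p₁ p₂ p₃ Kp Tp x‖ * ‖x - zs‖ ≤
      -((1 + c) / (1 - c)) *
        inner ℝ (x - zs) (fieldRHS Φ b₁ b₂ b₃ p₁ p₂ p₃ Kp Tp x) := by
  have h1c : 0 < 1 - c := sub_pos.2 hc.2
  have hc1 : 0 < 1 + c := by linarith [hc.1]
  have hω := omegaFactor_nonneg (Φ := Φ) (p₁ := p₁) (p₂ := p₂) (p₃ := p₃) hb₁ hb₂ hb₃ x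
  have hκ : 0 ≤ Kp / Tp * omegaFactor Φ b₁ b₂ b₃ p₁ p₂ p₃ x := by positivity
  rw [fieldRHS, inner_smul_right, norm_smul, neg_mul, norm_neg, Real.norm_of_nonneg hκ, neg_mul,
    neg_mul, mul_neg, neg_neg, mul_left_comm, mul_assoc]
  refine mul_le_mul_of_nonneg_left ?_ hκ
  calc ‖Φ x‖ * ‖x - zs‖ ≤ (1 + c) * ‖x - zs‖ * ‖x - zs‖ := by
        gcongr
        exact residual_norm_le hΦ0 hΦ x
    _ = (1 + c) / (1 - c) * ((1 - c) * ‖x - zs‖ ^ 2) := by field_simp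
    _ ≤ _ := by
        gcongr
        exact le_inner_residual hΦ0 hΦ x

theorem boundM₁_pos (hc : c ∈ Ioo (0 : ℝ) 1) (hk : 0 < Kp / Tp) (hb₁ : 0 < b₁) :
    0 < boundM₁ b₁ p₁ c Kp Tp := by
  have h1c : 0 < 1 - c := sub_pos.2 hc.2
  have hc1 : 0 < 1 + c := by linarith [hc.1]
  unfold boundM₁
  positivity

theorem boundM₂_pos (hc : c ∈ Ioo (0 : ℝ) 1) (hk : 0 < Kp / Tp) (hb₂ : 0 < b₂) :
    0 < boundM₂ b₂ p₂ c Kp Tp := by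
  have h1c : 0 < 1 - c := sub_pos.2 hc.2
  unfold boundM₂
  positivity

variable [CompleteSpace H]

theorem HasSettlingBound.settlesWithin_fieldRHS {g : ℝ → ℝ} {T : ℝ} (hT : HasSettlingBound g T)
    (hc : c ∈ Ioo (0 : ℝ) 1) (hk : 0 < Kp / Tp) (hb₁ : 0 < b₁) (hb₂ : 0 < b₂) (hb₃ : 0 < b₃)
    (hΦ0 : Φ zs = 0) (hΦ : ∀ x y, ‖(x - Φ x) - (y - Φ y)‖ ≤ c * ‖x - y‖)
    (hg : ∀ x, x ≠ zs → inner ℝ (x - zs) (fieldRHS Φ b₁ b₂ b₃ p₁ p₂ p₃ Kp Tp x) ≤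
      -g (1 / 2 * ‖x - zs‖ ^ 2)) :
    SettlesWithin (fieldRHS Φ b₁ b₂ b₃ p₁ p₂ p₃ Kp Tp) zs T :=
  hT.settlesWithin
    (fun _ hx => continuousAt_fieldRHS (lipschitzWith_residual hc.1.le hΦ).continuous
      (residual_ne_zero hc.2 hΦ0 hΦ hx))
    (inner_fieldRHS_nonpos hc.2 hk hb₁ hb₂ hb₃ hΦ0 hΦ) hg

theorem isFixedTimeStable_fieldRHS (hc : c ∈ Ioo (0 : ℝ) 1) (hk : 0 < Kp / Tp) (hb₁ : 0 < b₁)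
    (hb₂ : 0 < b₂) (hb₃ : 0 < b₃) (hp₁ : p₁ < 1) (hp₂ : 1 < p₂) (hΦ0 : Φ zs = 0)
    (hΦ : ∀ x y, ‖(x - Φ x) - (y - Φ y)‖ ≤ c * ‖x - y‖) :
    IsFixedTimeStable (fieldRHS Φ b₁ b₂ b₃ p₁ p₂ p₃ Kp Tp) zs := by
  have hT := hasSettlingBound_rpow_add_rpow (boundM₁_pos (p₁ := p₁) hc hk hb₁)
    (boundM₂_pos (p₂ := p₂) hc hk hb₂) (r₁ := (1 + p₁) / 2) (r₂ := (1 + p₂) / 2)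
    (by linarith) (by linarith)
  have hg := fun x (hx : x ≠ zs) => inner_fieldRHS_le_rpow (p₃ := p₃) hc hk hb₁ hb₂ hb₃ hp₁ hp₂
    hΦ0 hΦ hx
  have hcont := (lipschitzWith_residual hc.1.le hΦ).continuous
  have hne := fun x (hx : x ≠ zs) => residual_ne_zero hc.2 hΦ0 hΦ hx
  have hV0 : fieldRHS Φ b₁ b₂ b₃ p₁ p₂ p₃ Kp Tp zs = 0 := by rw [fieldRHS, hΦ0, smul_zero]
  have hset := hT.settlesWithin_fieldRHS hc hk hb₁ hb₂ hb₃ hΦ0 hΦ hg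
  refine ⟨⟨hV0, ?_, fun z₀ => ?_, fun z hz => (hset z hz).trans_lt ENNReal.ofReal_lt_top⟩,
    _, hset⟩
  · exact isLyapunovStable_of_dissipative (fun x hx => continuousAt_fieldRHS hcont (hne x hx))
      (inner_fieldRHS_nonpos hc.2 hk hb₁ hb₂ hb₃ hΦ0 hΦ)
  -- The settling bound `hT` is used here a second time, to make the new lifetime finite.
  · exact exists_isTrajectory_of_timeChange
      (κ := fun x => Kp / Tp * omegaFactor Φ b₁ b₂ b₃ p₁ p₂ p₃ x) hT (sub_pos.2 hc.2)
      (K := ⟨1 + c, by linarith [hc.1]⟩) (show (0 : ℝ) < 1 + c by linarith [hc.1])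
      (lipschitzWith_residual hc.1.le hΦ) (le_inner_residual hΦ0 hΦ) (inner_residual_le hΦ0 hΦ)
      (fun x hx => (continuousAt_omegaFactor hcont (hne x hx)).const_mul _)
      (fun x hx => mul_pos hk (omegaFactor_pos hb₁ hb₂ hb₃ (hne x hx)))
      (fun x => by rw [fieldRHS, neg_mul]) hV0
      (norm_fieldRHS_mul_le hc hk hb₁ hb₂ hb₃ hΦ0 hΦ) hg z₀

theorem predefinedGain_pos (hc : c ∈ Ioo (0 : ℝ) 1) (hb₁ : 0 < b₁) (hb₂ : 0 < b₂) (hb₃ : 0 < b₃)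
    (hp₁ : p₁ < 1) (hp₂ : 1 < p₂) : 0 < predefinedGain b₁ b₂ b₃ p₁ p₂ c := by
  have h1c : 0 < 1 - c := sub_pos.2 hc.2
  have hc1 : 0 < 1 + c := by linarith [hc.1]
  have h1 : 0 < 1 - p₁ := by linarith
  have h2 : 0 < p₂ - 1 := by linarith
  have h3 : 0 < Real.log (1 + b₃ * (2 : ℝ) ^ ((1 - p₁) / 2) * (1 + c) ^ (1 - p₁) / b₁) :=
    Real.log_pos (lt_add_of_pos_right _ (by positivity))
  have h4 : 0 < Real.log (1 + b₃ * (2 : ℝ) ^ ((1 - p₂) / 2) * (1 - c) ^ (1 - p₂) / b₂) :=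
    Real.log_pos (lt_add_of_pos_right _ (by positivity))
  unfold predefinedGain
  positivity

/-- With the gain `predefinedGain`, the logarithmic settling bound is the prescribed time. -/
theorem settlingBound_predefinedGain (hc : c ∈ Ioo (0 : ℝ) 1) (hb₁ : 0 < b₁) (hb₂ : 0 < b₂)
    (hb₃ : 0 < b₃) (hp₁ : p₁ < 1) (hp₂ : 1 < p₂) (hTp : 0 < Tp)
    (hKp : Kp = predefinedGain b₁ b₂ b₃ p₁ p₂ c) :
    Real.log (1 + 2 * (Kp / Tp) * (b₃ * (1 - c)) / boundM₁ b₁ p₁ c Kp Tp) /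
        (2 * (Kp / Tp) * (b₃ * (1 - c)) * (1 - (1 + p₁) / 2)) +
      Real.log (1 + 2 * (Kp / Tp) * (b₃ * (1 - c)) / boundM₂ b₂ p₂ c Kp Tp) /
        (2 * (Kp / Tp) * (b₃ * (1 - c)) * ((1 + p₂) / 2 - 1)) = Tp := by
  have hKp0 : 0 < Kp := hKp ▸ predefinedGain_pos hc hb₁ hb₂ hb₃ hp₁ hp₂
  have h1c : 0 < 1 - c := sub_pos.2 hc.2
  have hc1 : 0 < 1 + c := by linarith [hc.1]
  have h1 : 0 < 1 - p₁ := by linarith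
  have h2 : 0 < p₂ - 1 := by linarith
  have htwo : ∀ p : ℝ, (2 : ℝ) ^ ((1 - p) / 2) = 2 / 2 ^ ((1 + p) / 2) := fun p => by
    rw [show (1 - p) / 2 = 1 - (1 + p) / 2 by ring, Real.rpow_sub two_pos, Real.rpow_one]
  -- `Kp / Tp` cancels in these ratios, so the logarithms do not depend on it. The whole bound is
  -- then `Tp / Kp` times the gain formula, and equals `Tp` for this `Kp`.
  have e1 : 2 * (Kp / Tp) * (b₃ * (1 - c)) / boundM₁ b₁ p₁ c Kp Tp =
      b₃ * (2 : ℝ) ^ ((1 - p₁) / 2) * (1 + c) ^ (1 - p₁) / b₁ := by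
    rw [boundM₁, htwo]
    field_simp
  have e2 : 2 * (Kp / Tp) * (b₃ * (1 - c)) / boundM₂ b₂ p₂ c Kp Tp =
      b₃ * (2 : ℝ) ^ ((1 - p₂) / 2) * (1 - c) ^ (1 - p₂) / b₂ := by
    rw [boundM₂, htwo, Real.rpow_sub h1c, Real.rpow_one]
    field_simp
  rw [e1, e2]
  have e3 : 2 * (Kp / Tp) * (b₃ * (1 - c)) * (1 - (1 + p₁) / 2) =
      Kp / Tp * (b₃ * (1 - c) * (1 - p₁)) := by ring
  have e4 : 2 * (Kp / Tp) * (b₃ * (1 - c)) * ((1 + p₂) / 2 - 1) =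
      Kp / Tp * (b₃ * (1 - c) * (p₂ - 1)) := by ring
  have e5 : ∀ a b d e : ℝ, a / (Kp / Tp * b) + d / (Kp / Tp * e) =
      Tp / Kp * (1 / b * a + 1 / e * d) := by
    intro a b d e
    rw [div_mul_eq_div_div, div_mul_eq_div_div]
    field_simp
  rw [e3, e4, e5]
  have e6 : Tp / Kp * Kp = Tp := by field_simp
  exact (congrArg (Tp / Kp * ·) hKp.symm).trans e6

end Residual

/-! ### Assembly of the three assertions. -/

theorem mainTheorem4 {H : Type*} [NormedAddCommGroup H] [InnerProductSpace ℝ H]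
    [FiniteDimensional ℝ H] [CompleteSpace H]
    (h : H → ℝ) (φ : H → EReal)
    (hdiff : ContDiff ℝ 1 h) (hconv : ConvexOn ℝ Set.univ h)
    (φproper : IsProperFun φ) (φconv : IsConvexFun φ) (φlsc : LowerSemicontinuous φ)
    (η L γ : ℝ) (hη : 0 < η) (hL : 0 < L) (hγ : 0 < γ)
    (hmono : ∀ x y : H, η * ‖x - y‖ ^ 2 ≤ inner ℝ (gradient h x - gradient h y) (x - y))
    (hlip : ∀ x y : H, ‖gradient h x - gradient h y‖ ≤ L * ‖x - y‖)
    (hstep : γ * L ^ 2 < 2 * η)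
    (zs : H) (hzs : IsMinOn (fun z => (h z : EReal) + φ z) Set.univ zs)
    (b₁ b₂ b₃ p₁ p₂ : ℝ) (hb₁ : 0 < b₁) (hb₂ : 0 < b₂) (hb₃ : 0 < b₃)
    (hp₁ : p₁ ∈ Set.Ioo (0 : ℝ) 1) (hp₂ : 1 < p₂) :
    (∃ c ∈ Set.Ioo (0 : ℝ) 1, ∀ x y : H, ‖fwdBwd γ h φ x - fwdBwd γ h φ y‖ ≤ c * ‖x - y‖) ∧
    (∀ p₃ Kp Tp : ℝ, 0 ≤ p₃ → 0 < Kp → 0 < Tp →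
      IsFixedTimeStable (fieldRHS (fbResidual γ h φ) b₁ b₂ b₃ p₁ p₂ p₃ Kp Tp) zs) ∧
    ∀ c ∈ Set.Ioo (0 : ℝ) 1,
      (∀ x y : H, ‖fwdBwd γ h φ x - fwdBwd γ h φ y‖ ≤ c * ‖x - y‖) →
      (∀ p₃ Kp Tp : ℝ, 0 ≤ p₃ → 0 < Kp → 0 < Tp →
        ∃ M₁ M₂ r₁ r₂ : ℝ,
          M₁ = boundM₁ b₁ p₁ c Kp Tp ∧ M₂ = boundM₂ b₂ p₂ c Kp Tp ∧
          r₁ = (1 + p₁) / 2 ∧ r₂ = (1 + p₂) / 2 ∧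
          0 < M₁ ∧ 0 < M₂ ∧ r₁ ∈ Set.Ioo (1 / 2 : ℝ) 1 ∧ 1 < r₂ ∧
          SettlesWithin (fieldRHS (fbResidual γ h φ) b₁ b₂ b₃ p₁ p₂ p₃ Kp Tp) zs
            (1 / (M₁ * (1 - r₁)) + 1 / (M₂ * (r₂ - 1))) ∧
          ∀ α : ℝ, 1 < α → r₁ = 1 - 1 / (2 * α) → r₂ = 1 + 1 / (2 * α) →
            SettlesWithin (fieldRHS (fbResidual γ h φ) b₁ b₂ b₃ p₁ p₂ p₃ Kp Tp) zs
              (Real.pi * α / Real.sqrt (M₁ * M₂))) ∧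
      IsPredefinedTimeStable
        (fun Tp => fieldRHS (fbResidual γ h φ) b₁ b₂ b₃ p₁ p₂ 0
          (predefinedGain b₁ b₂ b₃ p₁ p₂ c) Tp) zs := by
  have hcontr := exists_lipschitz_fwdBwd hdiff φproper φconv φlsc hγ hzs hmono hlip hstep
  have hΦ0 : fbResidual γ h φ zs = 0 := by
    rw [fbResidual, fwdBwd_eq_self_of_isMinOn hdiff φproper φconv φlsc hγ hzs, sub_self]
  have hΦ : ∀ c, (∀ x y : H, ‖fwdBwd γ h φ x - fwdBwd γ h φ y‖ ≤ c * ‖x - y‖) →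
      ∀ x y, ‖(x - fbResidual γ h φ x) - (y - fbResidual γ h φ y)‖ ≤ c * ‖x - y‖ := by
    intro c hc x y
    simpa only [fbResidual, sub_sub_cancel] using hc x y
  refine ⟨hcontr, fun p₃ Kp Tp _ hKp hTp => ?_, fun c hc hcB => ⟨fun p₃ Kp Tp _ hKp hTp => ?_,
    fun Tp hTp => ?_⟩⟩
  · obtain ⟨c, hc, hcB⟩ := hcontr
    exact isFixedTimeStable_fieldRHS hc (div_pos hKp hTp) hb₁ hb₂ hb₃ hp₁.2 hp₂ hΦ0 (hΦ c hcB)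
  · have hk := div_pos hKp hTp
    have hM₁ := boundM₁_pos (p₁ := p₁) hc hk hb₁
    have hM₂ := boundM₂_pos (p₂ := p₂) hc hk hb₂
    have hg := fun x (hx : x ≠ zs) => inner_fieldRHS_le_rpow (p₃ := p₃) hc hk hb₁ hb₂ hb₃ hp₁.2 hp₂
      hΦ0 (hΦ c hcB) hx
    refine ⟨_, _, _, _, rfl, rfl, rfl, rfl, hM₁, hM₂,
      ⟨by linarith [hp₁.1], by linarith [hp₁.2]⟩, by linarith, ?_, fun α hα h₁ h₂ => ?_⟩
    · exact (hasSettlingBound_rpow_add_rpow hM₁ hM₂ (by linarith [hp₁.2])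
        (by linarith)).settlesWithin_fieldRHS hc hk hb₁ hb₂ hb₃ hΦ0 (hΦ c hcB) hg
    · rw [h₁, h₂] at hg
      exact (hasSettlingBound_arctan hM₁ hM₂ (by linarith)).settlesWithin_fieldRHS hc hk
        hb₁ hb₂ hb₃ hΦ0 (hΦ c hcB) hg
  · have hKp := predefinedGain_pos hc hb₁ hb₂ hb₃ hp₁.2 hp₂
    have hk := div_pos hKp hTp
    have h1c : 0 < 1 - c := sub_pos.2 hc.2
    refine ⟨isFixedTimeStable_fieldRHS hc hk hb₁ hb₂ hb₃ hp₁.2 hp₂ hΦ0 (hΦ c hcB), ?_⟩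
    have hT := hasSettlingBound_rpow_add_rpow_add_linear (boundM₁_pos (p₁ := p₁) hc hk hb₁)
      (boundM₂_pos (p₂ := p₂) hc hk hb₂)
      (show 0 < 2 * (predefinedGain b₁ b₂ b₃ p₁ p₂ c / Tp) * (b₃ * (1 - c)) by positivity)
      (r₁ := (1 + p₁) / 2) (r₂ := (1 + p₂) / 2) (by linarith [hp₁.2]) (by linarith)
    rw [settlingBound_predefinedGain hc hb₁ hb₂ hb₃ hp₁.2 hp₂ hTp rfl] at hT
    exact hT.settlesWithin_fieldRHS hc hk hb₁ hb₂ hb₃ hΦ0 (hΦ c hcB) fun x hx =>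
      inner_fieldRHS_le_rpow_add_linear hc hk hb₁ hb₂ hb₃ hp₁.2 hp₂ hΦ0 (hΦ c hcB) hx
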